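/- Let $K,N_T,N_R\ge 1$ be integers and $\gamma_1,\dots,\gamma_K>0$. For each $k$ let $\mathbf u_k\sim\mathcal{CN}(\mathbf 0,\mathbf I_{N_R})$ and $\mathbf v_k\sim\mathcal{CN}(\mathbf 0,\mathbf I_{N_T})$ be independent (i.i.d. circularly symmetric complex Gaussian entries of variance $1$), and suppose that the keyhole channel matrices $\mathbf H_k=\mathbf u_k\mathbf v_k^{\mathrm H}$, $k=1,\dots,K$, are independent. Put $X_k=\|\mathbf u_k\|^2\|\mathbf v_k\|^2$ and $X_{IR}=\prod_{k=1}^K\bigl(1+\tfrac{\gamma_k}{N_T}X_k\bigr)$. For $\operatorname{Re}s>0$ let $$G_{1,3}^{3,1}\!\left(\left.\begin{array}{c}1\\ s,N_T,N_R\end{array}\right|z\right)=\frac1{2\pi \mathrm i}\int_{\rho-\mathrm i\infty}^{\rho+\mathrm i\infty}\Gamma(s-t)\Gamma(N_T-t)\Gamma(N_R-t)\Gamma(t)\,z^t\,dt,\qquad z>0,$$ be the Meijer $G$-function, where $0<\rho<\min(\operatorname{Re}s,N_T,N_R)$; at $z=N_T/\gamma_k$ this integral converges absolutely and does not depend on $\rho$.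 Then for every $c<0$ and every $x>0$ the CDF of $X_{IR}$ is given by the absolutely convergent integral $$F_{X_{IR}}(x)=\frac1{2\pi \mathrm i}\int_{-c-\mathrm i\infty}^{-c+\mathrm i\infty}\frac{x^s}{s}\prod_{k=1}^K\frac{G_{1,3}^{3,1}\!\left(\left.\begin{array}{c}1\\ s,N_T,N_R\end{array}\right|\frac{N_T}{\gamma_k}\right)}{\Gamma(N_T)\Gamma(N_R)\Gamma(s)}\,ds .$$ Moreover, for every real rate $R$, the outage probability of MIMO-HARQ-IR, $$P_{out}^{IR}=\Pr\Bigl(\sum_{k=1}^K\log_2\det\bigl(\mathbf I_{N_R}+\tfrac{\gamma_k}{N_T}\mathbf H_k\mathbf H_k^{\mathrm H}\bigr)<R\Bigr),$$ equals the right-hand side at $x=2^R$. -/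

import Mathlib

open MeasureTheory ProbabilityTheory
open scoped Matrix

noncomputable section

namespace KeyholeHARQ

/-- The contour integral `(1 / (2 π i)) ∫ f(s) ds` along the upward vertical line `Re s = σ`,
parametrized as `s = σ + i y` with `ds = i dy`. -/
def lineIntegral (σ : ℝ) (f : ℂ → ℂ) : ℂ :=
  1 / (2 * Real.pi * Complex.I) * ∫ y : ℝ, f (σ + y * Complex.I) * Complex.I

/-- The Mellin-Barnes integrand of the Meijer function `G^{m,n}_{p,q}`, with upper parameters
`a 0, …, a (p-1)` and lower parameters `b 0, …, b (q-1)`: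
`∏_{j < m} Γ(b_j - t) ∏_{j < n} Γ(1 - a_j + t) z^t /
  (∏_{m ≤ j < q} Γ(1 - b_j + t) ∏_{n ≤ j < p} Γ(a_j - t))`. -/
def meijerIntegrand (m n : ℕ) {p q : ℕ} (a : Fin p → ℂ) (b : Fin q → ℂ) (z t : ℂ) : ℂ :=
  (∏ j : Fin q, if (j : ℕ) < m then Complex.Gamma (b j - t)
    else (Complex.Gamma (1 - b j + t))⁻¹) *
  (∏ j : Fin p, if (j : ℕ) < n then Complex.Gamma (1 - a j + t)
    else (Complex.Gamma (a j - t))⁻¹) * z ^ t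

/-- The vertical line `Re t = ρ` separates the two families of poles: it has the poles
`b_j + l` (`j < m`, `l ∈ ℕ`) of `Γ(b_j - t)` strictly to its right and the poles
`a_j - 1 - l` (`j < n`, `l ∈ ℕ`) of `Γ(1 - a_j + t)` strictly to its left. -/
def SeparatesPoles (m n : ℕ) {p q : ℕ} (a : Fin p → ℂ) (b : Fin q → ℂ) (ρ : ℝ) : Prop :=
  (∀ j : Fin q, (j : ℕ) < m → ∀ l : ℕ, ρ < (b j + l).re) ∧
  (∀ j : Fin p, (j : ℕ) < n → ∀ l : ℕ, (a j - 1 - l).re < ρ)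

open Classical in
/-- The Meijer function `G^{m,n}_{p,q}(z | a; b)` as a Mellin-Barnes integral along a vertical
line that separates the two families of poles. (The value `0` is used only for parameters for
which no straight line separates them, so that an indented contour would be needed.) -/
def meijerG (m n : ℕ) {p q : ℕ} (a : Fin p → ℂ) (b : Fin q → ℂ) (z : ℂ) : ℂ :=
  if h : ∃ ρ : ℝ, SeparatesPoles m n a b ρ then
    lineIntegral h.choose (meijerIntegrand m n a b z)
  else 0

/-- The Mellin-Barnes integral defining `meijerG` makes sense: there is a separating vertical line,
and along each such line the integral converges absolutely and has the same value. -/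
def MeijerGWellDefined (m n : ℕ) {p q : ℕ} (a : Fin p → ℂ) (b : Fin q → ℂ) (z : ℂ) : Prop :=
  (∃ ρ : ℝ, SeparatesPoles m n a b ρ) ∧
  ∀ ρ : ℝ, SeparatesPoles m n a b ρ →
    Complex.VerticalIntegrable (meijerIntegrand m n a b z) ρ ∧
    lineIntegral ρ (meijerIntegrand m n a b z) = meijerG m n a b z

/-- The circularly symmetric complex normal law `CN(0, 1)`: the real and imaginary parts are
independent real normal variables with mean `0` and variance `1 / 2`. -/
def stdComplexGaussian : Measure ℂ :=
  ((gaussianReal 0 (1 / 2)).prod (gaussianReal 0 (1 / 2))).map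
    (fun p : ℝ × ℝ => (p.1 : ℂ) + (p.2 : ℂ) * Complex.I)

/-- The law `CN(0, I_n)` of a vector with `n` independent `CN(0, 1)` entries. -/
def complexGaussianVector (n : ℕ) : Measure (EuclideanSpace ℂ (Fin n)) :=
  (Measure.pi (fun _ : Fin n => stdComplexGaussian)).map (WithLp.toLp 2)

/-- The keyhole channel matrix `H = u vᴴ`, with entries `u_i * conj (v_j)`. -/
def channel {NR NT : ℕ} (u : EuclideanSpace ℂ (Fin NR)) (v : EuclideanSpace ℂ (Fin NT)) :
    Matrix (Fin NR) (Fin NT) ℂ :=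
  Matrix.of fun i j => u i * star (v j)

/-- The mutual information of one round, `log₂ det (I + (γ / N_T) H Hᴴ)`. The determinant is a
(positive) real number, read off as a real part. -/
def mutualInfo {NR NT : ℕ} (γ : ℝ) (H : Matrix (Fin NR) (Fin NT) ℂ) : ℝ :=
  Real.logb 2 ((1 + ((γ / NT : ℝ) : ℂ) • (H * Hᴴ)).det).re

/-- `X_IR = ∏_k (1 + (γ_k / N_T) X_k)` with `X_k = ‖u_k‖² ‖v_k‖²`. -/
def XIR {Ω : Type*} {K NT NR : ℕ} (γ : Fin K → ℝ)
    (u : Fin K → Ω → EuclideanSpace ℂ (Fin NR)) (v : Fin K → Ω → EuclideanSpace ℂ (Fin NT))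
    (ω : Ω) : ℝ :=
  ∏ k, (1 + γ k / NT * (‖u k ω‖ ^ 2 * ‖v k ω‖ ^ 2))

/-- The outage probability of HARQ with incremental redundancy after `K` rounds at rate `R`: the
probability that the accumulated mutual information is less than `R`. -/
def outageIR {Ω : Type*} [MeasurableSpace Ω] (P : Measure Ω) {K NT NR : ℕ} (γ : Fin K → ℝ)
    (u : Fin K → Ω → EuclideanSpace ℂ (Fin NR)) (v : Fin K → Ω → EuclideanSpace ℂ (Fin NT))
    (R : ℝ) : ℝ :=
  P.real {ω | ∑ k, mutualInfo (γ k) (channel (u k ω) (v k ω)) < R}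

/-- The integrand `(x^s / s) ∏_k G^{3,1}_{1,3}(N_T / γ_k | 1; s, N_T, N_R) /
(Γ(N_T) Γ(N_R) Γ(s))`. -/
def irIntegrand {K : ℕ} (NT NR : ℕ) (γ : Fin K → ℝ) (x : ℝ) (s : ℂ) : ℂ :=
  (x : ℂ) ^ s / s *
    ∏ k, meijerG 3 1 ![1] ![s, (NT : ℂ), (NR : ℂ)] ((NT / γ k : ℝ) : ℂ) /
      (Complex.Gamma NT * Complex.Gamma NR * Complex.Gamma s)

end KeyholeHARQ

end

/-! Put `a = γ_k / N_T`. Since `X_IR ≥ 1`, the function `t ↦ F(1/t)` lives on `(0, 1]`, and Fubini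
gives its Mellin transform as `E[X_IR^(-s)] / s` for `Re s > 0` (`mellin_cdf_inv`). Mellin inversion
at `t = 1/x` is then the asserted contour integral, once the moments are identified and two analytic
conditions hold: integrability on the line and continuity of `F`.

Moments: `E[X_IR^(-s)]` is the product of the `E[(1 + a X_k)^(-s)]`. Write `Γ(s) (1 + a x)^(-s)` as
a Gamma integral of `exp (-r) exp (-a r x)`, insert the Mellin-Barnes formula for the second
exponential, and exchange integrals (`integral_one_add_mul_cpow_neg`). The inner averages are `Γ(s -
t)` and the moment `E[X_k^(-t)]`. As `X_k` is a product of independent Gamma variables of shapes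
`N_R` and `N_T`, that moment is a quotient of Gamma values, and the Meijer integral appears
(`meijerG_eq`).

Integrability: integrating by parts in one Gamma variable, with the other fixed, and interpolating
with the trivial bound 1 makes one factor `O(|s|^(-1/2))`. The other factors have modulus at most 1,
so the integrand is `O(|s|^(-3/2))` on a vertical line.

Continuity: `X_IR` has no atoms, because a single factor has none and the remaining product is
positive and independent of it. This also makes strict and weak inequality agree in the outage
event, which is an event about `X_IR` by the determinant formula for rank-one perturbations. -/

/-! ### Complex Gaussian vectors and the law of their squared norm -/

/-- Densities multiply: the finite product of a measure with an integrable density. -/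
theorem pi_withDensity_ofReal {α ι : Type*} [Fintype ι] [MeasurableSpace α] {μ : Measure α}
    [SigmaFinite μ] {f : α → ℝ} (hf : Integrable f μ) (h0 : ∀ x, 0 ≤ f x) :
    Measure.pi (fun _ : ι => μ.withDensity fun x => ENNReal.ofReal (f x)) =
      (Measure.pi fun _ : ι => μ).withDensity fun x => ENNReal.ofReal (∏ i, f (x i)) := by
  have : IsFiniteMeasure (μ.withDensity fun x => ENNReal.ofReal (f x)) :=
    isFiniteMeasure_withDensity_ofReal hf.2
  refine (Measure.pi_eq fun s hs => ?_)
  have hint : ∀ i, Integrable ((s i).indicator f) μ := fun i => hf.indicator (hs i)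
  rw [withDensity_apply _ (MeasurableSet.univ_pi hs), ← lintegral_indicator (MeasurableSet.univ_pi hs)]
  have h1 : ∀ x : ι → α, (Set.univ.pi s).indicator (fun x => ENNReal.ofReal (∏ i, f (x i))) x =
      ENNReal.ofReal (∏ i, (s i).indicator f (x i)) := by
    intro x
    by_cases hx : x ∈ Set.univ.pi s
    · rw [Set.indicator_of_mem hx]
      congr 1
      exact Finset.prod_congr rfl fun i _ => (Set.indicator_of_mem (hx i trivial) f).symm
    · rw [Set.indicator_of_notMem hx]
      simp only [Set.mem_pi, Set.mem_univ, true_imp_iff, not_forall] at hx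
      obtain ⟨i, hi⟩ := hx
      rw [Finset.prod_eq_zero (Finset.mem_univ i) (Set.indicator_of_notMem hi f)]
      simp
  have hnn : ∀ i x, 0 ≤ (s i).indicator f x := fun i x => Set.indicator_nonneg (fun y _ => h0 y) x
  simp_rw [h1]
  rw [← ofReal_integral_eq_lintegral_ofReal (Integrable.fintype_prod hint)
    (Filter.Eventually.of_forall fun x => Finset.prod_nonneg fun i _ => hnn i _),
    integral_fintype_prod_eq_prod (𝕜 := ℝ), ENNReal.ofReal_prod_of_nonneg
      (fun i _ => integral_nonneg (hnn i))]
  refine Finset.prod_congr rfl fun i _ => ?_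
  rw [withDensity_apply _ (hs i), ← lintegral_indicator (hs i),
    ofReal_integral_eq_lintegral_ofReal (hint i) (Filter.Eventually.of_forall (hnn i))]
  congr 1
  ext x
  by_cases hx : x ∈ s i <;> simp [hx]

theorem integral_gammaMeasure {E : Type*} [NormedAddCommGroup E] [NormedSpace ℝ E] {n : ℕ}
    (hn : 1 ≤ n) (g : ℝ → E) :
    ∫ x, g x ∂gammaMeasure n 1 =
      (Real.Gamma n)⁻¹ • ∫ x in Set.Ioi (0 : ℝ), (x ^ (n - 1) * Real.exp (-x)) • g x := by
  have hn0 : (0 : ℝ) < n := by exact_mod_cast hn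
  rw [gammaMeasure, integral_withDensity_eq_integral_toReal_smul (f := gammaPDF n 1)
    (by unfold gammaPDF; fun_prop) (Filter.Eventually.of_forall fun x => ENNReal.ofReal_lt_top),
    ← integral_smul, ← integral_Ici_eq_integral_Ioi, ← integral_indicator measurableSet_Ici]
  refine integral_congr_ae (Filter.Eventually.of_forall fun x => ?_)
  by_cases hx : 0 ≤ x
  · have he : (n : ℝ) - 1 = ((n - 1 : ℕ) : ℝ) := by push_cast [Nat.cast_sub hn]; rfl
    simp only [gammaPDF, ENNReal.toReal_ofReal (gammaPDFReal_nonneg hn0 one_pos x),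
      Set.indicator_of_mem (Set.mem_Ici.2 hx)]
    simp only [gammaPDFReal, if_pos hx, he, Real.rpow_natCast, smul_smul]
    simp [mul_assoc]
  · simp [gammaPDF, gammaPDFReal, hx]

namespace KeyholeHARQ

theorem integrable_stdComplexGaussian_density :
    Integrable fun z : ℂ => Real.pi⁻¹ * Real.exp (-‖z‖ ^ 2) := by
  refine Integrable.const_mul ?_ _
  have h := GaussianFourier.integrable_cexp_neg_mul_sq_norm_add (V := ℂ) (b := 1) (by simp) 0 0
  refine h.norm.congr (Filter.Eventually.of_forall fun z => ?_)
  simp only [Complex.norm_exp]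
  norm_cast
  simp

theorem stdComplexGaussian_eq_withDensity :
    stdComplexGaussian =
      volume.withDensity fun z : ℂ => ENNReal.ofReal (Real.pi⁻¹ * Real.exp (-‖z‖ ^ 2)) := by
  have he : (fun p : ℝ × ℝ => (p.1 : ℂ) + (p.2 : ℂ) * Complex.I) =
      Complex.measurableEquivRealProd.symm := by
    ext p
    exact (Complex.mk_eq_add_mul_I _ _).symm
  have hv : (1 / 2 : NNReal) ≠ 0 := by norm_num
  rw [stdComplexGaussian, he, gaussianReal_of_var_ne_zero _ hv,
    prod_withDensity (measurable_gaussianPDF _ _) (measurable_gaussianPDF _ _)]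
  ext S hS
  rw [MeasurableEquiv.map_apply, withDensity_apply _ (Complex.measurableEquivRealProd.symm.measurable hS),
    withDensity_apply _ hS, ← Complex.volume_preserving_equiv_real_prod.symm.setLIntegral_comp_preimage_emb
      (MeasurableEquiv.measurableEmbedding _)]
  refine lintegral_congr fun p => ?_
  have hn : ‖Complex.measurableEquivRealProd.symm p‖ ^ 2 = p.1 ^ 2 + p.2 ^ 2 := by
    rw [← Complex.normSq_eq_norm_sq, Complex.normSq_apply]
    simp [sq]
  rw [hn, gaussianPDF, gaussianPDF, ← ENNReal.ofReal_mul (gaussianPDFReal_nonneg _ _ _)]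
  congr 1
  rw [gaussianPDFReal, gaussianPDFReal]
  have h2 : (2 * Real.pi * ((1 / 2 : NNReal) : ℝ)) = Real.pi := by push_cast; ring
  have h3 : (2 * ((1 / 2 : NNReal) : ℝ)) = 1 := by push_cast; ring
  rw [h2, h3, mul_mul_mul_comm, ← mul_inv, Real.mul_self_sqrt Real.pi_pos.le, ← Real.exp_add]
  congr 2
  ring

instance : IsProbabilityMeasure stdComplexGaussian :=
  Measure.isProbabilityMeasure_map (by fun_prop)

instance (n : ℕ) : IsProbabilityMeasure (complexGaussianVector n) :=
  Measure.isProbabilityMeasure_map (by fun_prop)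

/-- The squared norm of a `CN(0, I_n)` vector is Gamma distributed with shape `n` and rate `1`. -/
theorem map_norm_sq_complexGaussianVector {n : ℕ} (hn : 1 ≤ n) :
    (complexGaussianVector n).map (fun x => ‖x‖ ^ 2) = gammaMeasure n 1 := by
  have hn0 : (0 : ℝ) < n := by exact_mod_cast hn
  have := isProbabilityMeasure_gammaMeasure hn0 one_pos
  have : NeZero n := ⟨by lia⟩
  have : IsProbabilityMeasure ((complexGaussianVector n).map (fun x => ‖x‖ ^ 2)) :=
    Measure.isProbabilityMeasure_map (by fun_prop)
  let L : (Fin n → ℂ) ≃L[ℝ] EuclideanSpace ℂ (Fin n) := PiLp.continuousLinearEquiv 2 ℝ _ |>.symm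
  -- Any Haar measure serves for polar coordinates; its normalization is irrelevant, as the total
  -- masses settle the constant at the end.
  let μ : Measure (EuclideanSpace ℂ (Fin n)) := (volume : Measure (Fin n → ℂ)).map L
  have : μ.IsAddHaarMeasure := L.isAddHaarMeasure_map _
  have hdim : Module.finrank ℝ (EuclideanSpace ℂ (Fin n)) = 2 * n := by
    rw [← Module.finrank_mul_finrank ℝ ℂ]
    simp
  obtain ⟨C, hC⟩ : ∃ C : ℝ, ∀ S : Set ℝ, MeasurableSet S →
      ((complexGaussianVector n).map (fun x => ‖x‖ ^ 2)).real S = C * (gammaMeasure n 1).real S := by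
    -- Polar coordinates in real dimension `2n` give `2n` times the ball volume, the density gives
    -- `π^(-n)`, the substitution `r = y²` gives `1/2`, and `Γ(n)` undoes the Gamma normalization.
    refine ⟨2 * n * μ.real (Metric.ball 0 1) * (Real.pi⁻¹ ^ n) * (1 / 2) * Real.Gamma n, fun S hS => ?_⟩
    have h1 : ((complexGaussianVector n).map (fun x => ‖x‖ ^ 2)).real S =
        ∫ x, S.indicator (fun r => Real.pi⁻¹ ^ n * Real.exp (-r)) (‖x‖ ^ 2) ∂μ := by
      have hm : Measurable fun x : EuclideanSpace ℂ (Fin n) => ‖x‖ ^ 2 := by fun_prop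
      have hm' : Measurable fun x : Fin n → ℂ => WithLp.toLp 2 x := by fun_prop
      have h0 : ∀ z : ℂ, 0 ≤ Real.pi⁻¹ * Real.exp (-‖z‖ ^ 2) := fun z => by positivity
      rw [map_measureReal_apply hm hS, complexGaussianVector,
        map_measureReal_apply hm' (hm hS), stdComplexGaussian_eq_withDensity,
        pi_withDensity_ofReal integrable_stdComplexGaussian_density h0,
        measureReal_def, withDensity_apply _ (hm' (hm hS)), ← integral_eq_lintegral_of_nonneg_ae
          (Filter.Eventually.of_forall fun x => Finset.prod_nonneg fun i _ => h0 _)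
          (Measurable.aestronglyMeasurable (by fun_prop)), ← integral_indicator (hm' (hm hS)),
        show μ = (volume : Measure (Fin n → ℂ)).map L.toHomeomorph from rfl,
        L.toHomeomorph.measurableEmbedding.integral_map]
      refine integral_congr_ae (Filter.Eventually.of_forall fun x => ?_)
      have hL : L.toHomeomorph x = WithLp.toLp 2 x := rfl
      simp only [hL]
      by_cases hx : ‖WithLp.toLp 2 x‖ ^ 2 ∈ S
      · rw [Set.indicator_of_mem hx, Set.indicator_of_mem (by exact hx), Finset.prod_mul_distrib,
          ← Real.exp_sum, EuclideanSpace.norm_sq_eq]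
        simp
      · rw [Set.indicator_of_notMem hx, Set.indicator_of_notMem (by exact hx)]
    have h2 : (gammaMeasure n 1).real S =
        (Real.Gamma n)⁻¹ * ∫ y in Set.Ioi (0 : ℝ), S.indicator (fun r => r ^ (n - 1) * Real.exp (-r)) y := by
      rw [← integral_indicator_one hS, integral_gammaMeasure hn, smul_eq_mul]
      congr 1
      refine integral_congr_ae (Filter.Eventually.of_forall fun x => ?_)
      by_cases hx : x ∈ S <;> simp [hx]
    have h3 : ∫ y in Set.Ioi (0 : ℝ), y ^ (2 * n - 1) •
          S.indicator (fun r => Real.pi⁻¹ ^ n * Real.exp (-r)) (y ^ 2) =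
        Real.pi⁻¹ ^ n * (1 / 2) *
          ∫ y in Set.Ioi (0 : ℝ), S.indicator (fun r => r ^ (n - 1) * Real.exp (-r)) y := by
      rw [← integral_comp_rpow_Ioi_of_pos (p := 2) two_pos
        (g := S.indicator fun r => r ^ (n - 1) * Real.exp (-r)), ← integral_const_mul]
      refine integral_congr_ae (Filter.Eventually.of_forall fun y => ?_)
      simp only [Real.rpow_two]
      by_cases hy : y ^ 2 ∈ S
      · have e : 2 * n - 1 = 1 + 2 * (n - 1) := by lia
        have e' : ((2 : ℝ) - 1) = 1 := by norm_num
        simp only [hy, Set.indicator_of_mem, smul_eq_mul, e, pow_add, pow_mul, e', Real.rpow_one]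
        ring
      · simp [hy]
    have hG := (Real.Gamma_pos_of_pos hn0).ne'
    rw [h1, h2, integral_fun_norm_addHaar μ
      (fun x => S.indicator (fun r => Real.pi⁻¹ ^ n * Real.exp (-r)) (x ^ 2)), hdim, h3]
    simp only [nsmul_eq_mul, smul_eq_mul]
    push_cast
    field_simp
  have hC1 : C = 1 := by
    have := hC Set.univ MeasurableSet.univ
    simpa using this.symm
  ext S hS
  have := hC S hS
  rwa [hC1, one_mul, measureReal_eq_measureReal_iff] at this

end KeyholeHARQ

/-! ### Gamma on vertical lines and Mellin-Barnes formulas -/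

theorem Complex.norm_Gamma_le {s : ℂ} (hs : 0 < s.re) : ‖Complex.Gamma s‖ ≤ Real.Gamma s.re := by
  rw [Complex.Gamma_eq_integral hs, Real.Gamma_eq_integral hs, Complex.GammaIntegral]
  refine (norm_integral_le_integral_norm _).trans (le_of_eq ?_)
  refine setIntegral_congr_fun measurableSet_Ioi fun x (hx : 0 < x) => ?_
  rw [norm_mul, Complex.norm_cpow_eq_rpow_re_of_pos hx, Complex.norm_real, Real.norm_eq_abs,
    abs_of_pos (Real.exp_pos _)]
  simp

theorem continuous_Gamma_comp {X : Type*} [TopologicalSpace X] {f : X → ℂ} (hf : Continuous f)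
    (h0 : ∀ x, 0 < (f x).re) : Continuous fun x => Complex.Gamma (f x) := by
  rw [continuous_iff_continuousAt]
  intro x
  refine ContinuousAt.comp (f := f) (g := Complex.Gamma) ?_ hf.continuousAt
  refine (Complex.differentiableAt_Gamma _ fun m hm => ?_).continuousAt
  have := h0 x
  rw [hm] at this
  simp only [Complex.neg_re, Complex.natCast_re] at this
  have : (0 : ℝ) ≤ m := Nat.cast_nonneg m
  linarith

/-- No Stirling estimate is needed: `Γ(t + 2) = (t + 1) t Γ(t)` is bounded on the line by `Γ(ρ +
2)`, and `|t + 1| |t|` grows quadratically. -/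
theorem Complex.verticalIntegrable_Gamma {ρ : ℝ} (hρ : 0 < ρ) :
    Complex.VerticalIntegrable Complex.Gamma ρ := by
  refine (integrable_inv_one_add_sq.const_mul (Real.Gamma (ρ + 2) * (min (ρ ^ 2) 1)⁻¹)).mono'
    (continuous_Gamma_comp (by fun_prop) (by simpa using hρ)).aestronglyMeasurable
    (Filter.Eventually.of_forall fun y => ?_)
  set t : ℂ := ρ + y * Complex.I with ht
  have hre : t.re = ρ := by simp [ht]
  have him : t.im = y := by simp [ht]
  have h0 : t ≠ 0 := fun h => by rw [h] at hre; simp at hre; linarith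
  have h1 : t + 1 ≠ 0 := fun h => by
    have := congrArg Complex.re h; simp [hre] at this; linarith
  have hG : Complex.Gamma (t + 2) = (t + 1) * (t * Complex.Gamma t) := by
    rw [← Complex.Gamma_add_one t h0, ← Complex.Gamma_add_one _ h1]
    congr 1
    ring
  have hb := Complex.norm_Gamma_le (s := t + 2) (by simp [hre]; linarith)
  have hsq : ‖t‖ ^ 2 = ρ ^ 2 + y ^ 2 := by
    rw [← Complex.normSq_eq_norm_sq, Complex.normSq_apply, hre, him]; ring
  have hsq1 : ‖t + 1‖ ^ 2 = (ρ + 1) ^ 2 + y ^ 2 := by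
    rw [← Complex.normSq_eq_norm_sq, Complex.normSq_apply]
    simp only [Complex.add_re, hre, Complex.one_re, Complex.add_im, him, Complex.one_im]; ring
  have hle : ‖t‖ ≤ ‖t + 1‖ := by
    refine le_of_sq_le_sq ?_ (norm_nonneg _)
    rw [hsq, hsq1]; nlinarith
  have hmin : min (ρ ^ 2) 1 * (1 + y ^ 2) ≤ ‖t + 1‖ * ‖t‖ := by
    have a1 := min_le_left (ρ ^ 2) 1
    have a2 := min_le_right (ρ ^ 2) 1
    have : min (ρ ^ 2) 1 * (1 + y ^ 2) ≤ ‖t‖ ^ 2 := by rw [hsq]; nlinarith [sq_nonneg y]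
    nlinarith [norm_nonneg t]
  rw [hG, norm_mul, norm_mul, ← mul_assoc] at hb
  have hm0 : 0 < min (ρ ^ 2) 1 := lt_min (by positivity) one_pos
  have : min (ρ ^ 2) 1 * (1 + y ^ 2) * ‖Complex.Gamma t‖ ≤ Real.Gamma (ρ + 2) := by
    refine (mul_le_mul_of_nonneg_right hmin (norm_nonneg _)).trans (hb.trans_eq ?_)
    simp [hre]
  rw [mul_assoc, ← mul_inv, ← div_eq_mul_inv, le_div_iff₀ (by positivity), mul_comm]
  exact this

/-- Mellin inversion, `Γ` being the Mellin transform of `exp (-x)`. -/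
theorem exp_neg_eq_integral_Gamma {ρ w : ℝ} (hρ : 0 < ρ) (hw : 0 < w) :
    (Real.exp (-w) : ℂ) = (1 / (2 * Real.pi) : ℝ) •
      ∫ y : ℝ, Complex.Gamma (ρ + y * Complex.I) * (w : ℂ) ^ (-(ρ + y * Complex.I)) := by
  have hG : ∀ y : ℝ, mellin (fun x : ℝ => (Real.exp (-x) : ℂ)) (ρ + y * Complex.I) =
      Complex.Gamma (ρ + y * Complex.I) := fun y => by
    rw [← Complex.GammaIntegral_eq_mellin, Complex.Gamma_eq_integral (by simpa using hρ)]
  have h := mellinInv_mellin_eq ρ (fun x : ℝ => (Real.exp (-x) : ℂ)) hw ?_ ?_ ?_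
  · rw [← h, mellinInv]
    simp_rw [hG, smul_eq_mul, mul_comm]
  · have := Complex.GammaIntegral_convergent (s := ρ) (by simpa using hρ)
    simpa only [MellinConvergent, smul_eq_mul, mul_comm] using this
  · simpa only [Complex.VerticalIntegrable, hG] using Complex.verticalIntegrable_Gamma hρ
  · fun_prop

/-- Averaging the Mellin-Barnes representation of `exp (-w)` over a weighted family `w = W p`. -/
theorem integral_mul_exp_neg_eq_integral_Gamma {α : Type*} [MeasurableSpace α] {μ : Measure α}
    [SFinite μ] {ρ : ℝ} (hρ : 0 < ρ) {g : α → ℂ} {W : α → ℝ} (hW : Measurable W)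
    (hg : AEStronglyMeasurable g μ) (hpos : ∀ᵐ p ∂μ, 0 < W p)
    (hint : Integrable (fun p => ‖g p‖ * W p ^ (-ρ)) μ) :
    ∫ p, g p * Real.exp (-W p) ∂μ = (1 / (2 * Real.pi) : ℝ) •
      ∫ y : ℝ, Complex.Gamma (ρ + y * Complex.I) *
        ∫ p, g p * (W p : ℂ) ^ (-(ρ + y * Complex.I)) ∂μ := by
  have hΓ := Complex.verticalIntegrable_Gamma hρ
  -- On the line `|W^(-t)| = W^(-ρ)` does not depend on `y`, so the modulus splits into a function
  -- of `y` times a function of `p`.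
  have hI : Integrable (Function.uncurry fun (y : ℝ) (p : α) =>
      Complex.Gamma (ρ + y * Complex.I) * (g p * (W p : ℂ) ^ (-(ρ + y * Complex.I))))
      (volume.prod μ) := by
    refine (hΓ.norm.mul_prod hint).mono' ?_ ?_
    · refine hΓ.aestronglyMeasurable.comp_fst.mul (hg.comp_snd.mul ?_)
      exact (Measurable.pow (by fun_prop) (by fun_prop)).aestronglyMeasurable
    · have : ∀ᵐ z ∂((volume : Measure ℝ).prod μ), 0 < W z.2 := Measure.quasiMeasurePreserving_snd.ae hpos
      filter_upwards [this] with z hz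
      simp only [Function.uncurry, norm_mul, Complex.norm_cpow_eq_rpow_re_of_pos hz]
      simp
  simp_rw [← integral_const_mul]
  rw [integral_integral_swap hI, ← integral_smul]
  refine integral_congr_ae ?_
  filter_upwards [hpos] with p hp
  rw [exp_neg_eq_integral_Gamma hρ hp, mul_smul_comm, ← integral_const_mul]
  congr 2
  ext y
  ring

/-- The Mellin-Barnes representation of the moments of `1 + a X`. -/
theorem integral_one_add_mul_cpow_neg {ν : Measure ℝ} [IsFiniteMeasure ν] {ρ a : ℝ} {s : ℂ}
    (hρ : 0 < ρ) (hρs : ρ < s.re) (ha : 0 < a) (hpos : ∀ᵐ x ∂ν, 0 < x)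
    (hint : Integrable (fun x => x ^ (-ρ)) ν) :
    Complex.Gamma s * ∫ x, (1 + a * x : ℂ) ^ (-s) ∂ν = (1 / (2 * Real.pi) : ℝ) •
      ∫ y : ℝ, Complex.Gamma (ρ + y * Complex.I) * (Complex.Gamma (s - (ρ + y * Complex.I)) *
        (a : ℂ) ^ (-(ρ + y * Complex.I)) * ∫ x, (x : ℂ) ^ (-(ρ + y * Complex.I)) ∂ν) := by
  have hs : 0 < s.re := hρ.trans hρs
  let μ := (volume.restrict (Set.Ioi (0 : ℝ))).prod ν
  let g : ℝ × ℝ → ℂ := fun p => (Real.exp (-p.1) : ℂ) * (p.1 : ℂ) ^ (s - 1)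
  have hpos1 : ∀ᵐ p ∂μ, 0 < p.1 :=
    Measure.quasiMeasurePreserving_fst.ae (ae_restrict_mem measurableSet_Ioi)
  have hpos2 : ∀ᵐ p ∂μ, 0 < p.2 := Measure.quasiMeasurePreserving_snd.ae hpos
  have hgm : Measurable g := by fun_prop
  -- With `W = a r x` and weight `exp (-r) r^(s-1)`, integrating `r` first on the left gives `Γ(s)
  -- (1 + a x)^(-s)`; on the right `W^(-t)` factorizes and the `r`-integral is `Γ(s - t)`.
  have key := integral_mul_exp_neg_eq_integral_Gamma (μ := μ) (g := g)
    (W := fun p => a * p.1 * p.2) hρ (by fun_prop) hgm.aestronglyMeasurable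
    (by filter_upwards [hpos1, hpos2] with p h1 h2; positivity) ?_
  · convert key using 2
    · have hI : Integrable (fun p : ℝ × ℝ => g p * Real.exp (-(a * p.1 * p.2))) μ := by
        have h1 : Integrable g μ :=
          (Complex.GammaIntegral_convergent hs).comp_fst ν
        refine h1.mono (by fun_prop) ?_
        filter_upwards [hpos1, hpos2] with p h1 h2
        rw [norm_mul, Complex.norm_real, Real.norm_eq_abs, Real.abs_exp]
        exact mul_le_of_le_one_right (norm_nonneg _)
          (Real.exp_le_one_iff.2 (by simp; positivity))
      rw [integral_prod_symm _ hI, ← integral_const_mul]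
      refine integral_congr_ae ?_
      filter_upwards [hpos] with x hx
      have h1 : 0 < 1 + a * x := by positivity
      have := Complex.integral_cpow_mul_exp_neg_mul_Ioi hs h1
      push_cast at this
      rw [one_div, Complex.inv_cpow _ _ (by
        rw [← Complex.ofReal_one, ← Complex.ofReal_mul, ← Complex.ofReal_add,
          Complex.arg_ofReal_of_nonneg h1.le]; exact Real.pi_pos.ne), ← Complex.cpow_neg] at this
      rw [mul_comm, ← this]
      refine integral_congr_ae (Filter.Eventually.of_forall fun r => ?_)
      simp only [g]
      push_cast
      rw [mul_comm (Complex.exp _), mul_assoc, ← Complex.exp_add]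
      congr 2
      ring
    · refine integral_congr_ae (Filter.Eventually.of_forall fun y => ?_)
      dsimp only
      congr 1
      set t : ℂ := ρ + y * Complex.I with ht
      have htre : t.re = ρ := by simp [ht]
      have hst : 0 < (s - t).re := by simp [htre, hρs]
      rw [Complex.Gamma_eq_integral hst, Complex.GammaIntegral, mul_right_comm, mul_comm _ ((a : ℂ) ^ (-t)),
        ← integral_prod_mul, ← integral_const_mul]
      refine integral_congr_ae ?_
      filter_upwards [hpos1, hpos2] with p h1 h2
      have hp1 : (p.1 : ℂ) ≠ 0 := by exact_mod_cast h1.ne'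
      push_cast
      rw [← Complex.ofReal_mul, Complex.mul_cpow_ofReal_nonneg (by positivity) h2.le,
        Complex.ofReal_mul, Complex.mul_cpow_ofReal_nonneg ha.le h1.le,
        show s - t - 1 = (s - 1) + -t by ring, Complex.cpow_add _ _ hp1]
      simp only [g]
      push_cast
      ring
  · have h1 : Integrable (fun r : ℝ => a ^ (-ρ) * (Real.exp (-r) * r ^ (s.re - ρ - 1)))
        (volume.restrict (Set.Ioi (0 : ℝ))) :=
      (Real.GammaIntegral_convergent (by linarith)).const_mul _
    refine (h1.mul_prod hint).congr ?_
    filter_upwards [hpos1, hpos2] with p h1 h2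
    simp only [g, norm_mul, Complex.norm_real, Complex.norm_cpow_eq_rpow_re_of_pos h1,
      Real.norm_eq_abs, Real.abs_exp]
    rw [Real.mul_rpow (by positivity) h2.le, Real.mul_rpow ha.le h1.le,
      show s.re - ρ - 1 = (s - 1).re + -ρ by simp; ring, Real.rpow_add h1]
    ring

/-! ### Moments of Gamma variables and of their products -/

/-- Negative complex moments of the Gamma distribution. -/
theorem integral_cpow_neg_gammaMeasure {n : ℕ} (hn : 1 ≤ n) {t : ℂ} (ht : t.re < n) :
    ∫ x : ℝ, (x : ℂ) ^ (-t) ∂gammaMeasure n 1 = Complex.Gamma (n - t) / Complex.Gamma n := by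
  rw [integral_gammaMeasure hn, Complex.Gamma_eq_integral (s := n - t) (by simpa using ht),
    Complex.GammaIntegral, div_eq_inv_mul, Complex.real_smul]
  push_cast
  rw [← Complex.Gamma_ofReal, Complex.ofReal_natCast]
  congr 1
  refine setIntegral_congr_fun measurableSet_Ioi fun x (hx : 0 < x) => ?_
  have hx' : (x : ℂ) ≠ 0 := by exact_mod_cast hx.ne'
  have e : (n : ℂ) - t - 1 = ((n - 1 : ℕ) : ℂ) + -t := by push_cast [Nat.cast_sub hn]; ring
  simp only [Complex.real_smul]
  rw [e, Complex.cpow_add _ _ hx', Complex.cpow_natCast]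
  push_cast
  ring

theorem ae_pos_gammaMeasure (n : ℕ) : ∀ᵐ x ∂gammaMeasure n 1, 0 < x := by
  rw [gammaMeasure, ae_withDensity_iff (by unfold gammaPDF; fun_prop)]
  filter_upwards [Measure.ae_ne volume (0 : ℝ)] with x hx h
  by_contra h'
  exact h (gammaPDF_of_neg (lt_of_le_of_ne (not_lt.1 h') hx))

theorem integrable_rpow_neg_gammaMeasure {n : ℕ} (hn : 1 ≤ n) {ρ : ℝ} (h : ρ < n) :
    Integrable (fun x : ℝ => x ^ (-ρ)) (gammaMeasure n 1) := by
  have hn0 : (0 : ℝ) < n := by exact_mod_cast hn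
  have h1 := integral_cpow_neg_gammaMeasure hn (t := ρ) (by simpa using h)
  have h2 : Integrable (fun x : ℝ => (x : ℂ) ^ (-(ρ : ℂ))) (gammaMeasure n 1) := by
    -- A non-integrable function has integral 0 by convention, but the moment formula gives a
    -- nonzero value.
    by_contra hc
    rw [integral_undef hc] at h1
    refine div_ne_zero ?_ ?_ h1.symm
    · rw [← Complex.ofReal_natCast, ← Complex.ofReal_sub, Complex.Gamma_ofReal]
      exact_mod_cast (Real.Gamma_pos_of_pos (sub_pos.2 h)).ne'
    · rw [← Complex.ofReal_natCast, Complex.Gamma_ofReal]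
      exact_mod_cast (Real.Gamma_pos_of_pos hn0).ne'
  refine h2.norm.congr ?_
  filter_upwards [ae_pos_gammaMeasure n] with x hx
  rw [Complex.norm_cpow_eq_rpow_re_of_pos hx]
  simp

theorem isProbabilityMeasure_gammaMeasure_natCast {n : ℕ} (hn : 1 ≤ n) :
    IsProbabilityMeasure (gammaMeasure n 1) :=
  isProbabilityMeasure_gammaMeasure (by exact_mod_cast hn) one_pos

namespace KeyholeHARQ

/-- The law of the product of independent Gamma variables with shapes `m` and `n`. -/
noncomputable def gammaProduct (m n : ℕ) : Measure ℝ :=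
  ((gammaMeasure m 1).prod (gammaMeasure n 1)).map fun p => p.1 * p.2

theorem isProbabilityMeasure_gammaProduct {m n : ℕ} (hm : 1 ≤ m) (hn : 1 ≤ n) :
    IsProbabilityMeasure (gammaProduct m n) := by
  have := isProbabilityMeasure_gammaMeasure_natCast hm
  have := isProbabilityMeasure_gammaMeasure_natCast hn
  exact Measure.isProbabilityMeasure_map (by fun_prop)

theorem ae_prod_pos {m n : ℕ} (hm : 1 ≤ m) (hn : 1 ≤ n) :
    ∀ᵐ p ∂(gammaMeasure m 1).prod (gammaMeasure n 1), 0 < p.1 ∧ 0 < p.2 := by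
  have := isProbabilityMeasure_gammaMeasure_natCast hm
  have := isProbabilityMeasure_gammaMeasure_natCast hn
  filter_upwards [Measure.quasiMeasurePreserving_fst.ae (ae_pos_gammaMeasure m),
    Measure.quasiMeasurePreserving_snd.ae (ae_pos_gammaMeasure n)] with p h1 h2 using ⟨h1, h2⟩

theorem ae_pos_gammaProduct {m n : ℕ} (hm : 1 ≤ m) (hn : 1 ≤ n) :
    ∀ᵐ x ∂gammaProduct m n, 0 < x := by
  rw [gammaProduct, ae_map_iff (by fun_prop) measurableSet_Ioi]
  filter_upwards [ae_prod_pos hm hn] with p hp using mul_pos hp.1 hp.2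

theorem integrable_rpow_neg_gammaProduct {m n : ℕ} (hm : 1 ≤ m) (hn : 1 ≤ n) {ρ : ℝ}
    (h1 : ρ < m) (h2 : ρ < n) : Integrable (fun x : ℝ => x ^ (-ρ)) (gammaProduct m n) := by
  have := isProbabilityMeasure_gammaMeasure_natCast hm
  have := isProbabilityMeasure_gammaMeasure_natCast hn
  rw [gammaProduct, integrable_map_measure (Measurable.aestronglyMeasurable (by fun_prop))
    (by fun_prop)]
  refine ((integrable_rpow_neg_gammaMeasure hm h1).mul_prod
    (integrable_rpow_neg_gammaMeasure hn h2)).congr ?_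
  filter_upwards [ae_prod_pos hm hn] with p hp
  exact (Real.mul_rpow hp.1.le hp.2.le).symm

theorem integral_cpow_neg_gammaProduct {m n : ℕ} (hm : 1 ≤ m) (hn : 1 ≤ n) {t : ℂ}
    (h1 : t.re < m) (h2 : t.re < n) :
    ∫ x : ℝ, (x : ℂ) ^ (-t) ∂gammaProduct m n =
      Complex.Gamma (m - t) / Complex.Gamma m * (Complex.Gamma (n - t) / Complex.Gamma n) := by
  have := isProbabilityMeasure_gammaMeasure_natCast hm
  have := isProbabilityMeasure_gammaMeasure_natCast hn
  rw [gammaProduct, integral_map (by fun_prop) (Measurable.aestronglyMeasurable (by fun_prop)),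
    ← integral_cpow_neg_gammaMeasure hm h1, ← integral_cpow_neg_gammaMeasure hn h2,
    ← integral_prod_mul]
  refine integral_congr_ae ?_
  filter_upwards [ae_prod_pos hm hn] with p hp
  rw [Complex.ofReal_mul, Complex.mul_cpow_ofReal_nonneg hp.1.le hp.2.le]

/-! ### The Meijer function as a moment -/

theorem lineIntegral_eq (σ : ℝ) (f : ℂ → ℂ) :
    lineIntegral σ f = (1 / (2 * Real.pi) : ℝ) • ∫ y : ℝ, f (σ + y * Complex.I) := by
  rw [lineIntegral, integral_mul_const, Complex.real_smul]
  push_cast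
  field_simp

theorem separatesPoles_iff {s : ℂ} {m n : ℕ} {ρ : ℝ} :
    SeparatesPoles 3 1 ![1] ![s, (m : ℂ), (n : ℂ)] ρ ↔ (ρ < s.re ∧ ρ < m ∧ ρ < n) ∧ 0 < ρ := by
  have key : ∀ r : ℝ, (∀ l : ℕ, ρ < r + l) ↔ ρ < r := fun r =>
    ⟨fun h => by simpa using h 0, fun h l => h.trans_le (by simp)⟩
  have key2 : (∀ l : ℕ, -(l : ℝ) < ρ) ↔ 0 < ρ :=
    ⟨fun h => by simpa using h 0, fun h l => lt_of_le_of_lt (by simp) h⟩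
  simp [SeparatesPoles, Fin.forall_fin_succ, key, key2]

theorem meijerIntegrand_eq (s : ℂ) (m n : ℕ) (z t : ℂ) :
    meijerIntegrand 3 1 ![1] ![s, (m : ℂ), (n : ℂ)] z t =
      Complex.Gamma (s - t) * Complex.Gamma (m - t) * Complex.Gamma (n - t) * Complex.Gamma t *
        z ^ t := by
  simp [meijerIntegrand, Fin.prod_univ_three]

theorem Gamma_natCast_ne_zero {n : ℕ} (hn : 1 ≤ n) : Complex.Gamma n ≠ 0 :=
  Complex.Gamma_ne_zero_of_re_pos (by simpa using Nat.lt_of_lt_of_le one_pos hn)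

/-- The factor `Γ(t)` alone provides integrability; the other Gamma factors and `z^t` are bounded on
the line. -/
theorem verticalIntegrable_meijerIntegrand {s : ℂ} {m n : ℕ} {ρ z : ℝ} (hz : 0 < z)
    (h : SeparatesPoles 3 1 ![1] ![s, (m : ℂ), (n : ℂ)] ρ) :
    Complex.VerticalIntegrable (meijerIntegrand 3 1 ![1] ![s, (m : ℂ), (n : ℂ)] z) ρ := by
  obtain ⟨⟨h1, h2, h3⟩, h0⟩ := separatesPoles_iff.1 h
  have hsub : ∀ {w : ℂ}, ρ < w.re → ∀ y : ℝ, (w - (ρ + y * Complex.I)).re = w.re - ρ := fun _ y => by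
    simp
  have hc : ∀ {w : ℂ}, ρ < w.re →
      Continuous fun y : ℝ => Complex.Gamma (w - (ρ + y * Complex.I)) := fun hw =>
    continuous_Gamma_comp (by fun_prop) fun y => by rw [hsub hw]; linarith
  have hb : ∀ {w : ℂ}, ρ < w.re → ∀ y : ℝ,
      ‖Complex.Gamma (w - (ρ + y * Complex.I))‖ ≤ Real.Gamma (w.re - ρ) := fun hw y => by
    have := Complex.norm_Gamma_le (s := _ - (ρ + y * Complex.I)) (by rw [hsub hw y]; linarith)
    rwa [hsub hw y] at this
  have h2' : ρ < (m : ℂ).re := by simpa using h2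
  have h3' : ρ < (n : ℂ).re := by simpa using h3
  have hz0 : (z : ℂ) ≠ 0 := by exact_mod_cast hz.ne'
  have hzc : Continuous fun y : ℝ => (z : ℂ) ^ (ρ + y * Complex.I) :=
    Continuous.const_cpow (by fun_prop) (Or.inl hz0)
  refine ((((Complex.verticalIntegrable_Gamma h0).bdd_mul (hc h3').aestronglyMeasurable
    (Filter.Eventually.of_forall (hb h3'))).bdd_mul (hc h2').aestronglyMeasurable
    (Filter.Eventually.of_forall (hb h2'))).bdd_mul (hc h1).aestronglyMeasurable
    (Filter.Eventually.of_forall (hb h1))).mul_bdd (c := z ^ ρ) hzc.aestronglyMeasurable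
    (Filter.Eventually.of_forall fun y => ?_) |>.congr (Filter.Eventually.of_forall fun y => ?_)
  · rw [Complex.norm_cpow_eq_rpow_re_of_pos hz]
    simp
  · simp only [meijerIntegrand_eq]
    ring

/-- The right-hand side does not contain `ρ`, so independence of the separating line follows without
shifting contours. -/
theorem lineIntegral_meijerIntegrand {s : ℂ} {m n : ℕ} (hm : 1 ≤ m) (hn : 1 ≤ n) {ρ a : ℝ}
    (ha : 0 < a) (h : SeparatesPoles 3 1 ![1] ![s, (m : ℂ), (n : ℂ)] ρ) :
    lineIntegral ρ (meijerIntegrand 3 1 ![1] ![s, (m : ℂ), (n : ℂ)] (a⁻¹ : ℝ)) =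
      Complex.Gamma m * Complex.Gamma n * Complex.Gamma s *
        ∫ x, (1 + a * x : ℂ) ^ (-s) ∂gammaProduct n m := by
  obtain ⟨⟨h1, h2, h3⟩, h0⟩ := separatesPoles_iff.1 h
  have := isProbabilityMeasure_gammaProduct hn hm
  rw [mul_assoc, integral_one_add_mul_cpow_neg h0 h1 ha (ae_pos_gammaProduct hn hm)
    (integrable_rpow_neg_gammaProduct hn hm h3 h2), lineIntegral_eq, mul_smul_comm,
    ← integral_const_mul]
  congr 2
  ext y
  have hm0 := Gamma_natCast_ne_zero hm
  have hn0 := Gamma_natCast_ne_zero hn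
  rw [integral_cpow_neg_gammaProduct hn hm (by simpa using h3) (by simpa using h2),
    meijerIntegrand_eq, Complex.ofReal_inv, Complex.inv_cpow _ _ (by
      rw [Complex.arg_ofReal_of_nonneg ha.le]; exact Real.pi_pos.ne), ← Complex.cpow_neg]
  field_simp

theorem exists_separatesPoles {s : ℂ} (hs : 0 < s.re) {m n : ℕ} (hm : 1 ≤ m) (hn : 1 ≤ n) :
    ∃ ρ : ℝ, SeparatesPoles 3 1 ![1] ![s, (m : ℂ), (n : ℂ)] ρ := by
  have hm' : (0 : ℝ) < m := by exact_mod_cast hm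
  have hn' : (0 : ℝ) < n := by exact_mod_cast hn
  obtain ⟨ρ, h0, h1⟩ := exists_between (lt_min hs (lt_min hm' hn'))
  simp only [lt_min_iff] at h1
  exact ⟨ρ, separatesPoles_iff.2 ⟨h1, h0⟩⟩

theorem meijerG_eq {s : ℂ} (hs : 0 < s.re) {m n : ℕ} (hm : 1 ≤ m) (hn : 1 ≤ n) {a : ℝ}
    (ha : 0 < a) :
    meijerG 3 1 ![1] ![s, (m : ℂ), (n : ℂ)] (a⁻¹ : ℝ) =
      Complex.Gamma m * Complex.Gamma n * Complex.Gamma s *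
        ∫ x, (1 + a * x : ℂ) ^ (-s) ∂gammaProduct n m := by
  have h := exists_separatesPoles hs hm hn
  rw [meijerG, dif_pos h, lineIntegral_meijerIntegrand hm hn ha h.choose_spec]

theorem meijerGWellDefined {s : ℂ} (hs : 0 < s.re) {m n : ℕ} (hm : 1 ≤ m) (hn : 1 ≤ n) {a : ℝ}
    (ha : 0 < a) :
    MeijerGWellDefined 3 1 ![1] ![s, (m : ℂ), (n : ℂ)] (a⁻¹ : ℝ) :=
  ⟨exists_separatesPoles hs hm hn, fun ρ hρ =>
    ⟨verticalIntegrable_meijerIntegrand (by positivity) hρ,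
      by rw [lineIntegral_meijerIntegrand hm hn ha hρ, meijerG_eq hs hm hn ha]⟩⟩

end KeyholeHARQ

/-! ### Decay of the moments along vertical lines -/

theorem norm_one_add_mul_cpow_neg_le_one {b x : ℝ} (hb : 0 < b) (hx : 0 ≤ x) {s : ℂ}
    (hs : 0 < s.re) : ‖(1 + b * x : ℂ) ^ (-s)‖ ≤ 1 := by
  have h1 : 1 ≤ 1 + b * x := by nlinarith [mul_nonneg hb.le hx]
  rw [← Complex.ofReal_mul, ← Complex.ofReal_one, ← Complex.ofReal_add,
    Complex.norm_cpow_eq_rpow_re_of_pos (by linarith)]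
  exact Real.rpow_le_one_of_one_le_of_nonpos h1 (by simp [hs.le])

theorem integrableOn_pow_mul_exp_neg (k : ℕ) :
    IntegrableOn (fun x : ℝ => x ^ k * Real.exp (-x)) (Set.Ioi 0) := by
  have := Real.GammaIntegral_convergent (s := k + 1) (by positivity)
  simpa [mul_comm] using this

/-- Decay of the moments of `1 + b U`, `U` Gamma distributed, along vertical lines. -/
theorem exists_norm_integral_one_add_mul_cpow_neg_gammaMeasure_le {n : ℕ} (hn : 1 ≤ n) :
    ∃ A B : ℝ, 0 ≤ A ∧ 0 ≤ B ∧ ∀ b : ℝ, 0 < b → ∀ s : ℂ, 0 < s.re →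
      ‖∫ x : ℝ, (1 + b * x : ℂ) ^ (-s) ∂gammaMeasure n 1‖ ≤ (A / b + B) / ‖s‖ := by
  obtain ⟨k, rfl⟩ : ∃ k, n = k + 1 := ⟨n - 1, by lia⟩
  let p : ℝ → ℝ := fun x => x ^ k * Real.exp (-x)
  -- At `k = 0` the truncated exponent `k - 1` is harmless, since its coefficient vanishes.
  let p' : ℝ → ℝ := fun x => (k * x ^ (k - 1) - x ^ k) * Real.exp (-x)
  have hpd : ∀ x, HasDerivAt p (p' x) x := fun x => by
    refine ((hasDerivAt_pow k x).mul (Real.hasDerivAt_exp (-x) |>.comp x (hasDerivAt_neg x))).congr_deriv ?_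
    simp only [p', Function.comp]
    ring
  have hp : IntegrableOn p (Set.Ioi 0) := integrableOn_pow_mul_exp_neg k
  have hp' : IntegrableOn p' (Set.Ioi 0) := by
    refine (((integrableOn_pow_mul_exp_neg (k - 1)).const_mul (k : ℝ)).sub
      (integrableOn_pow_mul_exp_neg k)).congr (Filter.Eventually.of_forall fun x => ?_)
    simp only [p', Pi.sub_apply]; ring
  have hxp' : IntegrableOn (fun x => x * p' x) (Set.Ioi 0) := by
    refine (((integrableOn_pow_mul_exp_neg (k - 1 + 1)).const_mul (k : ℝ)).sub
      (integrableOn_pow_mul_exp_neg (k + 1))).congr (Filter.Eventually.of_forall fun x => ?_)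
    simp only [p', Pi.sub_apply]; ring
  set J1 := ∫ x in Set.Ioi 0, ‖p x‖
  set J2 := ∫ x in Set.Ioi 0, ‖p' x‖
  set J3 := ∫ x in Set.Ioi 0, ‖x * p' x‖
  have hJ1 : 0 ≤ J1 := integral_nonneg fun _ => norm_nonneg _
  have hJ2 : 0 ≤ J2 := integral_nonneg fun _ => norm_nonneg _
  have hJ3 : 0 ≤ J3 := integral_nonneg fun _ => norm_nonneg _
  have hG : 0 < Real.Gamma (k + 1) := Real.Gamma_pos_of_pos (by positivity)
  refine ⟨(Real.Gamma (k + 1))⁻¹ * (|p 0| + J2), (Real.Gamma (k + 1))⁻¹ * (J1 + J3), by positivity,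
    by positivity, fun b hb s hs => ?_⟩
  have hs0 : s ≠ 0 := fun h => by simp [h] at hs
  let c : ℝ → ℂ := fun x => (1 + b * x : ℂ) ^ (-s)
  have hbase : ∀ {x : ℝ}, 0 ≤ x → 0 < 1 + b * x := fun hx => by positivity
  have hslit : ∀ {x : ℝ}, 0 ≤ x → (1 + b * x : ℂ) ∈ Complex.slitPlane := fun hx => by
    exact_mod_cast Complex.ofReal_mem_slitPlane.2 (hbase hx)
  have hne : ∀ {x : ℝ}, 0 ≤ x → (1 + b * x : ℂ) ≠ 0 := fun hx =>
    Complex.slitPlane_ne_zero (hslit hx)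
  -- The factor `1 + b x` restores the power lost by differentiating `c`: thus `F' = -s b c p + R`,
  -- where `s` enters `R` only through `c`, of modulus at most 1. Integrating `F'` yields `s b ∫ c p
  -- = p(0) + ∫ R`.
  let F : ℝ → ℂ := fun x => c x * ((1 + b * x) * p x : ℝ)
  let R : ℝ → ℂ := fun x => c x * (b * p x + p' x + b * (x * p' x) : ℝ)
  have hcm : Measurable c := by fun_prop
  have hcb : ∀ᵐ x ∂volume.restrict (Set.Ioi (0 : ℝ)), ‖c x‖ ≤ 1 := by
    filter_upwards [ae_restrict_mem measurableSet_Ioi] with x hx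
    exact norm_one_add_mul_cpow_neg_le_one hb (le_of_lt hx) hs
  have hcp : IntegrableOn (fun x => c x * (p x : ℂ)) (Set.Ioi 0) :=
    (hp.ofReal).bdd_mul hcm.aestronglyMeasurable hcb
  have hq : IntegrableOn (fun x => b * p x + p' x + b * (x * p' x)) (Set.Ioi 0) :=
    ((hp.const_mul b).add hp').add (hxp'.const_mul b)
  have hR : IntegrableOn R (Set.Ioi 0) := hq.ofReal.bdd_mul hcm.aestronglyMeasurable hcb
  have hF : ∀ x ∈ Set.Ici (0 : ℝ), HasDerivAt F (-(s * b) * (c x * p x) + R x) x := by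
    intro x hx
    have h1 : HasDerivAt (fun x : ℝ => (1 + b * x : ℂ)) b x := by
      simpa using ((hasDerivAt_id x).ofReal_comp.const_mul (b : ℂ)).const_add 1
    have h2 : HasDerivAt c (-s * (1 + b * x : ℂ) ^ (-s - 1) * b) x :=
      HasDerivAt.comp x (h₂ := fun z : ℂ => z ^ (-s)) (h₂' := -s * (1 + b * x : ℂ) ^ (-s - 1))
        (((hasDerivAt_id _).cpow_const (hslit hx)).congr_deriv (by simp)) h1
    have h3 : HasDerivAt (fun x : ℝ => (1 + b * x) * p x) (b * p x + (1 + b * x) * p' x) x := by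
      exact ((((hasDerivAt_id x).const_mul b).const_add 1).mul (hpd x)).congr_deriv (by simp)
    refine (h2.mul h3.ofReal_comp).congr_deriv ?_
    rw [Complex.cpow_sub _ _ (hne hx), Complex.cpow_one]
    simp only [R, c]
    have := hne hx
    push_cast
    field_simp
    ring
  have hlim : Filter.Tendsto F Filter.atTop (nhds 0) := by
    have h1 : Filter.Tendsto (fun x : ℝ => (1 + b * x) * p x) Filter.atTop (nhds 0) := by
      have := (Real.tendsto_pow_mul_exp_neg_atTop_nhds_zero k).add
        ((Real.tendsto_pow_mul_exp_neg_atTop_nhds_zero (k + 1)).const_mul b)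
      simp only [mul_zero, add_zero] at this
      refine this.congr fun x => ?_
      simp only [p]; ring
    refine squeeze_zero_norm' ?_ h1
    filter_upwards [Filter.eventually_ge_atTop 0] with x hx
    have hq0 : 0 ≤ (1 + b * x) * p x := mul_nonneg (hbase hx).le (by simp only [p]; positivity)
    rw [norm_mul, Complex.norm_real, Real.norm_eq_abs, abs_of_nonneg hq0]
    exact mul_le_of_le_one_left hq0 (norm_one_add_mul_cpow_neg_le_one hb hx hs)
  have hint := integral_Ioi_of_hasDerivAt_of_tendsto' hF ((hcp.const_mul _).add hR) hlim
  rw [integral_add (hcp.const_mul _) hR, integral_const_mul] at hint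
  have hF0 : F 0 = (p 0 : ℝ) := by simp [F, c]
  have hsb : s * b * ∫ x in Set.Ioi 0, c x * (p x : ℂ) = (p 0 : ℝ) + ∫ x in Set.Ioi 0, R x := by
    rw [hF0] at hint
    linear_combination -hint
  have hRn : ‖∫ x in Set.Ioi 0, R x‖ ≤ b * J1 + J2 + b * J3 := by
    have e : b * J1 + J2 + b * J3 =
        ∫ x in Set.Ioi 0, (b * ‖p x‖ + ‖p' x‖ + b * ‖x * p' x‖) := by
      rw [integral_add (f := fun x => b * ‖p x‖ + ‖p' x‖)
          ((hp.norm.const_mul b).add hp'.norm) (hxp'.norm.const_mul b),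
        integral_add (hp.norm.const_mul b) hp'.norm, integral_const_mul, integral_const_mul]
    rw [e]
    refine norm_integral_le_of_norm_le
      (((hp.norm.const_mul b).add hp'.norm).add (hxp'.norm.const_mul b)) ?_
    filter_upwards [hcb] with x hx
    rw [norm_mul, Complex.norm_real]
    refine (mul_le_of_le_one_left (norm_nonneg _) hx).trans ((norm_add₃_le).trans (le_of_eq ?_))
    simp only [norm_mul, Real.norm_eq_abs, abs_of_pos hb]
  have hval : ∫ x : ℝ, (1 + b * x : ℂ) ^ (-s) ∂gammaMeasure ((k + 1 : ℕ) : ℝ) 1 =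
      ((Real.Gamma (k + 1))⁻¹ : ℝ) * ∫ x in Set.Ioi 0, c x * (p x : ℂ) := by
    rw [integral_gammaMeasure hn, Complex.real_smul]
    simp only [Complex.real_smul, Nat.add_sub_cancel, p, c]
    push_cast
    simp_rw [mul_comm]
  have hn1 : ‖s‖ * b * ‖∫ x in Set.Ioi 0, c x * (p x : ℂ)‖ ≤ |p 0| + (b * J1 + J2 + b * J3) := by
    have := congrArg norm hsb
    rw [norm_mul, norm_mul, Complex.norm_real, Real.norm_eq_abs, abs_of_pos hb] at this
    rw [this]
    refine (norm_add_le _ _).trans (add_le_add (by simp) hRn)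
  have hsn : 0 < ‖s‖ := norm_pos_iff.2 hs0
  rw [hval, norm_mul, Complex.norm_real, Real.norm_eq_abs, abs_of_pos (inv_pos.2 hG),
    le_div_iff₀ hsn]
  have : ‖∫ x in Set.Ioi 0, c x * (p x : ℂ)‖ * ‖s‖ ≤ (|p 0| + J2) / b + (J1 + J3) := by
    rw [div_add' _ _ _ hb.ne', le_div_iff₀ hb]
    linarith
  calc _ = (Real.Gamma (k + 1))⁻¹ * (‖∫ x in Set.Ioi 0, c x * (p x : ℂ)‖ * ‖s‖) := by ring
    _ ≤ (Real.Gamma (k + 1))⁻¹ * ((|p 0| + J2) / b + (J1 + J3)) :=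
      mul_le_mul_of_nonneg_left this (inv_pos.2 hG).le
    _ = _ := by ring

namespace KeyholeHARQ

/-- Condition on the second Gamma variable `v` and apply the previous bound with `b = a v`. Its
`1/v` is not integrable for shape 1, so the bound is interpolated with 1, leaving `v^(-1/2)` at the
price of decay only `|s|^(-1/2)`. -/
theorem exists_norm_integral_one_add_mul_cpow_neg_le {m n : ℕ} (hm : 1 ≤ m) (hn : 1 ≤ n) {a : ℝ}
    (ha : 0 < a) : ∃ C : ℝ, ∀ s : ℂ, 0 < s.re →
      ‖∫ x : ℝ, (1 + a * x : ℂ) ^ (-s) ∂gammaProduct m n‖ ≤ C * ‖s‖ ^ (-(1 / 2) : ℝ) := by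
  have := isProbabilityMeasure_gammaMeasure_natCast hm
  have := isProbabilityMeasure_gammaMeasure_natCast hn
  obtain ⟨A, B, hA, hB, h⟩ := exists_norm_integral_one_add_mul_cpow_neg_gammaMeasure_le hm
  have hI : Integrable (fun v : ℝ => √(A / a) * v ^ (-(1 / 2) : ℝ) + √B) (gammaMeasure n 1) :=
    ((integrable_rpow_neg_gammaMeasure hn (by
      have : (1 : ℝ) ≤ n := by exact_mod_cast hn
      linarith)).const_mul _).add (integrable_const _)
  refine ⟨∫ v, (√(A / a) * v ^ (-(1 / 2) : ℝ) + √B) ∂gammaMeasure n 1, fun s hs => ?_⟩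
  have hs0 : 0 < ‖s‖ := norm_pos_iff.2 fun h => by simp [h] at hs
  have hi : Integrable (fun p : ℝ × ℝ => (1 + a * ((p.1 * p.2 : ℝ) : ℂ)) ^ (-s))
      ((gammaMeasure m 1).prod (gammaMeasure n 1)) := by
    refine Integrable.of_bound (C := 1) (Measurable.aestronglyMeasurable (by fun_prop)) ?_
    filter_upwards [ae_prod_pos hm hn] with p hp
    exact norm_one_add_mul_cpow_neg_le_one ha (mul_pos hp.1 hp.2).le hs
  rw [gammaProduct, integral_map (by fun_prop) (Measurable.aestronglyMeasurable (by fun_prop)),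
    integral_prod_symm _ hi, ← integral_mul_const]
  refine norm_integral_le_of_norm_le (hI.mul_const _) ?_
  filter_upwards [ae_pos_gammaMeasure n] with v hv
  have e : ∀ u : ℝ, (1 + a * ((u * v : ℝ) : ℂ)) ^ (-s) = (1 + (a * v : ℝ) * u : ℂ) ^ (-s) := by
    intro u; push_cast; ring_nf
  simp only [e]
  set I := ∫ u : ℝ, (1 + (a * v : ℝ) * u : ℂ) ^ (-s) ∂gammaMeasure m 1
  have hb := h (a * v) (by positivity) s hs
  have h1 : ‖I‖ ≤ 1 := by
    have := norm_integral_le_of_norm_le_const (μ := gammaMeasure m 1) (C := 1)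
      (f := fun u : ℝ => (1 + (a * v : ℝ) * u : ℂ) ^ (-s)) (by
        filter_upwards [ae_pos_gammaMeasure m] with u hu
        exact norm_one_add_mul_cpow_neg_le_one (by positivity) hu.le hs)
    simpa only [probReal_univ, mul_one] using this
  -- As `|I| ≤ 1`, `|I|² ≤ |I|`, which is at most the quantity under the root.
  have hsq : ‖I‖ ≤ √((A / (a * v) + B) / ‖s‖) := by
    refine Real.le_sqrt_of_sq_le (le_trans ?_ hb)
    nlinarith [norm_nonneg I]
  refine hsq.trans ?_
  rw [Real.sqrt_div (by positivity), div_eq_mul_inv, Real.rpow_neg hs0.le, ← Real.sqrt_eq_rpow]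
  refine mul_le_mul_of_nonneg_right ?_ (by positivity)
  rw [Real.rpow_neg hv.le, ← Real.sqrt_eq_rpow, ← div_eq_mul_inv, ← Real.sqrt_div (by positivity),
    div_div]
  refine Real.sqrt_le_iff.2 ⟨by positivity, ?_⟩
  nlinarith [Real.sq_sqrt hB, Real.sq_sqrt (show 0 ≤ A / (a * v) by positivity),
    mul_nonneg (Real.sqrt_nonneg (A / (a * v))) (Real.sqrt_nonneg B)]

end KeyholeHARQ

/-! ### Mellin inversion of a distribution function; absence of atoms -/

theorem continuous_cdf (μ : Measure ℝ) [IsProbabilityMeasure μ] [NullSingletonClass μ] :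
    Continuous (cdf μ) := by
  refine continuous_iff_continuousAt.2 fun x => ?_
  have h1 : (cdf μ).measure {x} = 0 := by rw [measure_cdf]; exact measure_singleton x
  rw [StieltjesFunction.measure_singleton, ENNReal.ofReal_eq_zero] at h1
  have h2 := (monotone_cdf μ).leftLim_le (le_refl x)
  rw [(monotone_cdf μ).continuousAt_iff_leftLim_eq_rightLim, StieltjesFunction.rightLim_eq]
  linarith

/-- Mellin transform of `t ↦ cdf ν (1 / t)`. -/
theorem mellin_cdf_inv {ν : Measure ℝ} [IsProbabilityMeasure ν] (h1 : ∀ᵐ y ∂ν, 1 ≤ y) {s : ℂ}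
    (hs : 0 < s.re) :
    MellinConvergent (fun t => (cdf ν t⁻¹ : ℂ)) s ∧
      mellin (fun t => (cdf ν t⁻¹ : ℂ)) s = (∫ y, (y : ℂ) ^ (-s) ∂ν) / s := by
  -- `cdf ν (1/t)` is the `ν`-integral over `y` of the indicator of `t y ≤ 1`. For `y ≥ 1` this
  -- forces `t ≤ 1`, whence the dominating function `t^(Re s - 1)` on `(0, 1]`.
  let A : Set (ℝ × ℝ) := {p | p.1 * p.2 ≤ 1}
  have hA : MeasurableSet A := measurableSet_le (by fun_prop) measurable_const
  let G : ℝ → ℝ → ℂ := fun t y => (t : ℂ) ^ (s - 1) * A.indicator 1 (t, y)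
  have hpos : ∀ᵐ z ∂(volume.restrict (Set.Ioi (0 : ℝ))).prod ν, 0 < z.1 :=
    Measure.quasiMeasurePreserving_fst.ae (ae_restrict_mem measurableSet_Ioi)
  have hge : ∀ᵐ z ∂(volume.restrict (Set.Ioi (0 : ℝ))).prod ν, 1 ≤ z.2 :=
    Measure.quasiMeasurePreserving_snd.ae h1
  have hdom : Integrable ((Set.Ioc (0 : ℝ) 1).indicator fun t : ℝ => t ^ (s.re - 1))
      (volume.restrict (Set.Ioi (0 : ℝ))) := by
    refine Integrable.restrict ?_
    rw [integrable_indicator_iff measurableSet_Ioc,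
      ← intervalIntegrable_iff_integrableOn_Ioc_of_le zero_le_one]
    exact intervalIntegral.intervalIntegrable_rpow' (by linarith)
  have hGm : Measurable (Function.uncurry G) := by
    have : Measurable (A.indicator (1 : ℝ × ℝ → ℂ)) := measurable_one.indicator hA
    simp only [G, Function.uncurry_def]
    fun_prop
  have hG : Integrable (Function.uncurry G) ((volume.restrict (Set.Ioi (0 : ℝ))).prod ν) := by
    refine (hdom.comp_fst ν).mono' hGm.aestronglyMeasurable ?_
    filter_upwards [hpos, hge] with z hz hz1
    simp only [Function.uncurry, G]
    by_cases h : (z.1, z.2) ∈ A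
    · have h' : z.1 * z.2 ≤ 1 := h
      have : z.1 ∈ Set.Ioc (0 : ℝ) 1 := ⟨hz, by nlinarith⟩
      simp [h, this, Complex.norm_cpow_eq_rpow_re_of_pos hz]
    · simp only [h, not_false_eq_true, Set.indicator_of_notMem, mul_zero, norm_zero]
      exact Set.indicator_nonneg (fun t ht => Real.rpow_nonneg ht.1.le _) _
  have hinner : ∀ t ∈ Set.Ioi (0 : ℝ), ∫ y, G t y ∂ν = (t : ℂ) ^ (s - 1) • (cdf ν t⁻¹ : ℂ) := by
    intro t (ht : 0 < t)
    have hset : (fun y => A.indicator (1 : ℝ × ℝ → ℂ) (t, y)) = (Set.Iic t⁻¹).indicator 1 := by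
      ext y
      have : (t, y) ∈ A ↔ y ∈ Set.Iic t⁻¹ := by
        simp only [A, Set.mem_ofPred_eq, Set.mem_Iic, ← one_div, le_div_iff₀ ht, mul_comm]
      by_cases h : y ∈ Set.Iic t⁻¹
      · rw [Set.indicator_of_mem h, Set.indicator_of_mem (this.2 h)]; rfl
      · rw [Set.indicator_of_notMem h, Set.indicator_of_notMem (mt this.1 h)]
    simp only [G]
    rw [integral_const_mul, hset, integral_indicator measurableSet_Iic, cdf_eq_real]
    simp
  constructor
  · exact hG.integral_prod_left.congr (by
      filter_upwards [ae_restrict_mem measurableSet_Ioi] with t ht using hinner t ht)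
  · rw [mellin, ← setIntegral_congr_fun measurableSet_Ioi hinner, integral_integral_swap hG,
      ← integral_div]
    refine integral_congr_ae ?_
    filter_upwards [h1] with y hy
    have hy0 : 0 < y := by linarith
    have hset : Set.EqOn (fun t => G t y)
        ((Set.Ioc 0 y⁻¹).indicator fun t : ℝ => (t : ℂ) ^ (s - 1)) (Set.Ioi 0) := by
      intro t (ht : 0 < t)
      have : (t, y) ∈ A ↔ t ∈ Set.Ioc 0 y⁻¹ := by
        simp [A, Set.mem_Ioc, ht, ← one_div, le_div_iff₀ hy0]
      by_cases h : t ∈ Set.Ioc 0 y⁻¹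
      · simp [G, h, this.2 h]
      · simp [G, h, mt this.1 h]
    rw [setIntegral_congr_fun measurableSet_Ioi hset, setIntegral_indicator measurableSet_Ioc,
      Set.inter_eq_right.2 fun t ht => ht.1,
      ← intervalIntegral.integral_of_le (by positivity), integral_cpow (Or.inl (by simp [hs]))]
    have hs0 : s ≠ 0 := fun h => by simp [h] at hs
    rw [sub_add_cancel, Complex.ofReal_zero, Complex.zero_cpow hs0, sub_zero, Complex.ofReal_inv,
      Complex.inv_cpow _ _ (by rw [Complex.arg_ofReal_of_nonneg hy0.le]; exact Real.pi_pos.ne),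
      Complex.cpow_neg]

/-- Perron-type inversion: the distribution function from the moments along a vertical line. -/
theorem cdf_eq_integral_moments {ν : Measure ℝ} [IsProbabilityMeasure ν] [NullSingletonClass ν]
    (h1 : ∀ᵐ y ∂ν, 1 ≤ y) {σ : ℝ} (hσ : 0 < σ)
    (hv : Complex.VerticalIntegrable (fun s => (∫ y, (y : ℂ) ^ (-s) ∂ν) / s) σ) {x : ℝ}
    (hx : 0 < x) :
    (cdf ν x : ℂ) = (1 / (2 * Real.pi) : ℝ) • ∫ y : ℝ, (x : ℂ) ^ (σ + y * Complex.I : ℂ) /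
      (σ + y * Complex.I) * ∫ r, (r : ℂ) ^ (-(σ + y * Complex.I)) ∂ν := by
  have hre : ∀ y : ℝ, 0 < (σ + y * Complex.I : ℂ).re := fun y => by simpa using hσ
  have h := mellinInv_mellin_eq σ (fun t => (cdf ν t⁻¹ : ℂ)) (inv_pos.2 hx)
    (mellin_cdf_inv h1 (by simpa using hσ)).1 ?_ ?_
  · rw [inv_inv] at h
    rw [← h, mellinInv]
    congr 2
    ext y
    rw [(mellin_cdf_inv h1 (hre y)).2, Complex.ofReal_inv, Complex.inv_cpow _ _ (by
      rw [Complex.arg_ofReal_of_nonneg hx.le]; exact Real.pi_pos.ne), ← Complex.cpow_neg, neg_neg,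
      smul_eq_mul]
    ring
  · refine hv.congr (Filter.Eventually.of_forall fun y => ?_)
    exact (mellin_cdf_inv h1 (hre y)).2.symm
  · exact Complex.continuous_ofReal.continuousAt.comp
      ((continuous_cdf ν).continuousAt.comp (continuousAt_inv₀ (inv_pos.2 hx).ne'))

/-- For fixed `b ≠ 0` the equation `a b = c` has at most one solution `a`, so Fubini gives each
point mass zero. -/
theorem nullSingletonClass_map_mul {Ω : Type*} [MeasurableSpace Ω] {P : Measure Ω} [IsProbabilityMeasure P]
    {A B : Ω → ℝ} (hA : AEMeasurable A P) (hB : AEMeasurable B P) (h : IndepFun A B P)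
    (hn : NullSingletonClass (P.map A)) (h0 : ∀ᵐ ω ∂P, B ω ≠ 0) :
    NullSingletonClass (P.map fun ω => A ω * B ω) := by
  have := Measure.isProbabilityMeasure_map hA
  have := Measure.isProbabilityMeasure_map hB
  refine ⟨fun c => ?_⟩
  have hm : Measurable fun p : ℝ × ℝ => p.1 * p.2 := by fun_prop
  have e : P.map (fun ω => A ω * B ω) = ((P.map A).prod (P.map B)).map fun p => p.1 * p.2 := by
    rw [← (indepFun_iff_map_prod_eq_prod_map_map hA hB).1 h,
      AEMeasurable.map_map_of_aemeasurable hm.aemeasurable (hA.prodMk hB)]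
    rfl
  have hS := hm (measurableSet_singleton c)
  rw [e, Measure.map_apply hm (measurableSet_singleton c), Measure.prod_apply_symm hS,
    lintegral_eq_zero_iff (measurable_measure_prodMk_right hS)]
  have h0' : ∀ᵐ b ∂P.map B, b ≠ 0 := by
    exact (ae_map_iff hB (measurableSet_singleton (0 : ℝ)).compl).2 h0
  filter_upwards [h0'] with b hb
  refine Set.Subsingleton.measure_zero (fun a ha a' ha' => ?_) _
  simp only [Set.mem_preimage, Set.mem_singleton_iff] at ha ha'
  exact mul_right_cancel₀ hb (ha.trans ha'.symm)

theorem Complex.ofReal_prod_cpow {ι : Type*} (S : Finset ι) {y : ι → ℝ} (hy : ∀ i, 0 ≤ y i) (t : ℂ) :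
    ((∏ i ∈ S, y i : ℝ) : ℂ) ^ t = ∏ i ∈ S, (y i : ℂ) ^ t := by
  induction S using Finset.cons_induction with
  | empty => simp
  | cons a S ha ih =>
    rw [Finset.prod_cons, Finset.prod_cons, Complex.ofReal_mul, Complex.mul_cpow_ofReal_nonneg (hy a)
      (Finset.prod_nonneg fun i _ => hy i), ih]

/-! ### The keyhole channel: determinant, gains, absence of atoms -/

namespace KeyholeHARQ

theorem nullSingletonClass_gammaMeasure (n : ℕ) : NullSingletonClass (gammaMeasure n 1) := by
  unfold gammaMeasure; infer_instance

/-- `H Hᴴ` equals `‖v‖² u uᴴ`, of rank at most one, so `det (1 + x yᵀ) = 1 + yᵀ x` applies. -/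
theorem det_one_add_smul_channel_mul_conjTranspose {NR NT : ℕ} (u : EuclideanSpace ℂ (Fin NR))
    (v : EuclideanSpace ℂ (Fin NT)) (c : ℂ) :
    (1 + c • (channel u v * (channel u v)ᴴ)).det = 1 + c * (‖u‖ ^ 2 * ‖v‖ ^ 2 : ℝ) := by
  have h : c • (channel u v * (channel u v)ᴴ) =
      Matrix.replicateCol Unit (fun i => c * (‖v‖ ^ 2 : ℝ) * u i) *
        Matrix.replicateRow Unit (fun j => star (u j)) := by
    ext i j
    simp only [channel, Matrix.smul_apply, Matrix.mul_apply, Matrix.of_apply,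
      Matrix.conjTranspose_apply, smul_eq_mul, Matrix.replicateCol_apply,
      Matrix.replicateRow_apply, Finset.univ_unique, Finset.sum_singleton,
      EuclideanSpace.norm_sq_eq, Complex.ofReal_sum, Finset.mul_sum, Finset.sum_mul, star_mul',
      star_star]
    refine Finset.sum_congr rfl fun k _ => ?_
    have := Complex.mul_conj' (v k)
    push_cast
    rw [← this]
    simp only [Complex.star_def]
    ring
  rw [h, Matrix.det_one_add_replicateCol_mul_replicateRow]
  simp only [dotProduct, EuclideanSpace.norm_sq_eq u]
  push_cast
  rw [Finset.sum_mul, Finset.mul_sum]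
  congr 1
  refine Finset.sum_congr rfl fun k _ => ?_
  have := Complex.mul_conj' (u k)
  rw [← this]
  simp only [Complex.star_def]
  ring

theorem mutualInfo_channel {NR NT : ℕ} (γ : ℝ) (u : EuclideanSpace ℂ (Fin NR))
    (v : EuclideanSpace ℂ (Fin NT)) :
    mutualInfo γ (channel u v) = Real.logb 2 (1 + γ / NT * (‖u‖ ^ 2 * ‖v‖ ^ 2)) := by
  rw [mutualInfo, det_one_add_smul_channel_mul_conjTranspose]
  norm_cast

theorem sum_norm_sq_channel {NR NT : ℕ} (u : EuclideanSpace ℂ (Fin NR))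
    (v : EuclideanSpace ℂ (Fin NT)) :
    ∑ i, ∑ j, ‖channel u v i j‖ ^ 2 = ‖u‖ ^ 2 * ‖v‖ ^ 2 := by
  simp only [EuclideanSpace.norm_sq_eq, Finset.sum_mul_sum, channel, Matrix.of_apply, norm_mul,
    mul_pow, norm_star]

section Model

variable {Ω : Type*} [MeasurableSpace Ω] {P : Measure Ω} {NT NR : ℕ}

theorem hasLaw_norm_sq {n : ℕ} (hn : 1 ≤ n) {u : Ω → EuclideanSpace ℂ (Fin n)}
    (hu : HasLaw u (complexGaussianVector n) P) :
    HasLaw (fun ω => ‖u ω‖ ^ 2) (gammaMeasure n 1) P where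
  aemeasurable := by have := hu.aemeasurable; fun_prop
  map_eq := by
    rw [← map_norm_sq_complexGaussianVector hn, ← hu.map_eq,
      AEMeasurable.map_map_of_aemeasurable (by fun_prop) hu.aemeasurable]
    rfl

theorem hasLaw_gain [IsProbabilityMeasure P] (hNT : 1 ≤ NT) (hNR : 1 ≤ NR) {u : Ω → EuclideanSpace ℂ (Fin NR)}
    {v : Ω → EuclideanSpace ℂ (Fin NT)} (hu : HasLaw u (complexGaussianVector NR) P)
    (hv : HasLaw v (complexGaussianVector NT) P) (huv : IndepFun u v P) :
    HasLaw (fun ω => ‖u ω‖ ^ 2 * ‖v ω‖ ^ 2) (gammaProduct NR NT) P := by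
  have hu' := hasLaw_norm_sq hNR hu
  have hv' := hasLaw_norm_sq hNT hv
  have hi : IndepFun (fun ω => ‖u ω‖ ^ 2) (fun ω => ‖v ω‖ ^ 2) P :=
    huv.comp (φ := fun x => ‖x‖ ^ 2) (ψ := fun x => ‖x‖ ^ 2) (by fun_prop) (by fun_prop)
  refine ⟨hu'.aemeasurable.mul hv'.aemeasurable, ?_⟩
  rw [gammaProduct, ← hu'.map_eq, ← hv'.map_eq,
    ← (indepFun_iff_map_prod_eq_prod_map_map hu'.aemeasurable hv'.aemeasurable).1 hi,
    AEMeasurable.map_map_of_aemeasurable (by fun_prop) (hu'.aemeasurable.prodMk hv'.aemeasurable)]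
  rfl

theorem nullSingletonClass_gammaProduct (hNT : 1 ≤ NT) (hNR : 1 ≤ NR) : NullSingletonClass (gammaProduct NR NT) := by
  have h1 := isProbabilityMeasure_gammaMeasure_natCast hNT
  have h2 := isProbabilityMeasure_gammaMeasure_natCast hNR
  refine nullSingletonClass_map_mul (P := (gammaMeasure NR 1).prod (gammaMeasure NT 1)) (by fun_prop)
    (by fun_prop) (indepFun_prod measurable_id measurable_id) ?_ ?_
  · rw [Measure.map_fst_prod, measure_univ, one_smul]
    exact nullSingletonClass_gammaMeasure NR
  · filter_upwards [ae_prod_pos hNR hNT] with p hp using hp.2.ne'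

theorem nullSingletonClass_map_one_add_mul {X : Ω → ℝ} (hX : AEMeasurable X P) (h : NullSingletonClass (P.map X))
    {a : ℝ} (ha : a ≠ 0) : NullSingletonClass (P.map fun ω => 1 + a * X ω) := by
  refine ⟨fun c => ?_⟩
  have hm : Measurable fun x : ℝ => 1 + a * x := by fun_prop
  have e : P.map (fun ω => 1 + a * X ω) = (P.map X).map fun x => 1 + a * x := by
    rw [AEMeasurable.map_map_of_aemeasurable hm.aemeasurable hX]; rfl
  rw [e, Measure.map_apply hm (measurableSet_singleton c)]
  refine Set.Subsingleton.measure_zero (fun x hx y hy => ?_) _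
  simp only [Set.mem_preimage, Set.mem_singleton_iff] at hx hy
  exact mul_left_cancel₀ ha (by linarith)

end Model

end KeyholeHARQ

/-! ### Moments, integrability and outage for `X_IR` -/

namespace KeyholeHARQ

theorem integrable_rpow_neg_norm_line {σ r : ℝ} (hσ : 0 < σ) (hr : 1 < r) :
    Integrable fun y : ℝ => ‖(σ + y * Complex.I : ℂ)‖ ^ (-r) := by
  have h := (integrable_one_add_norm (E := ℝ) (μ := volume) (r := r) (by simpa using hr)).const_mul
    (((1 + σ⁻¹) ^ (-r))⁻¹)
  have hpos : ∀ y : ℝ, σ ≤ ‖(σ + y * Complex.I : ℂ)‖ := fun y => by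
    have := Complex.abs_re_le_norm (σ + y * Complex.I : ℂ)
    simpa [abs_of_pos hσ] using this
  refine h.mono' (Measurable.aestronglyMeasurable (by fun_prop))
    (Filter.Eventually.of_forall fun y => ?_)
  have h1 := hpos y
  have h2 : ‖y‖ ≤ ‖(σ + y * Complex.I : ℂ)‖ := by
    have := Complex.abs_im_le_norm (σ + y * Complex.I : ℂ)
    simpa using this
  set N := ‖(σ + y * Complex.I : ℂ)‖
  have hN : 0 < N := hσ.trans_le h1
  have h3 : 1 + ‖y‖ ≤ (1 + σ⁻¹) * N := by
    have : 1 ≤ σ⁻¹ * N := by rw [inv_mul_eq_div, one_le_div hσ]; exact h1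
    linarith
  rw [Real.norm_eq_abs, abs_of_pos (Real.rpow_pos_of_pos hN _), inv_mul_eq_div,
    le_div_iff₀ (by positivity), mul_comm, ← Real.mul_rpow (by positivity) hN.le]
  exact Real.rpow_le_rpow_of_nonpos (by positivity) h3 (by linarith)

section Model

variable {Ω : Type*} {K NT NR : ℕ} {γ : Fin K → ℝ}
  {u : Fin K → Ω → EuclideanSpace ℂ (Fin NR)} {v : Fin K → Ω → EuclideanSpace ℂ (Fin NT)}

theorem one_le_factor (hγ : ∀ k, 0 < γ k) (k : Fin K) (ω : Ω) :
    1 ≤ 1 + γ k / NT * (‖u k ω‖ ^ 2 * ‖v k ω‖ ^ 2) := by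
  have := (hγ k).le
  have : 0 ≤ γ k / NT * (‖u k ω‖ ^ 2 * ‖v k ω‖ ^ 2) := by positivity
  linarith

theorem one_le_XIR (hγ : ∀ k, 0 < γ k) (ω : Ω) : 1 ≤ XIR γ u v ω := by
  have := Finset.prod_le_prod (s := Finset.univ) (f := fun _ : Fin K => (1 : ℝ))
    (fun _ _ => zero_le_one) fun k _ => one_le_factor (u := u) (v := v) hγ k ω
  rw [Finset.prod_const_one] at this
  exact this

variable [MeasurableSpace Ω] {P : Measure Ω}

/-- Independence between rounds is given for the matrices only, so the gain must be read off the
matrix: it is the squared Frobenius norm of `H_k`. -/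
theorem iIndepFun_gain
    (hH : iIndepFun (m := fun _ => (MeasurableSpace.pi : MeasurableSpace (Fin NR → Fin NT → ℂ)))
      (fun k ω => channel (u k ω) (v k ω)) P) :
    iIndepFun (fun k ω => ‖u k ω‖ ^ 2 * ‖v k ω‖ ^ 2) P := by
  have h := hH.comp (γ := fun _ => ℝ)
    (fun _ (M : Fin NR → Fin NT → ℂ) => ∑ i, ∑ j, ‖M i j‖ ^ 2) (fun _ => by fun_prop)
  convert h using 2 with k
  ext ω
  exact (sum_norm_sq_channel (u k ω) (v k ω)).symm

theorem aemeasurable_XIR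
    (hX : ∀ k, HasLaw (fun ω => ‖u k ω‖ ^ 2 * ‖v k ω‖ ^ 2) (gammaProduct NR NT) P) :
    AEMeasurable (XIR γ u v) P :=
  Finset.univ.aemeasurable_fun_prod fun k _ => ((hX k).aemeasurable.const_mul _).const_add _

theorem integral_XIR_cpow_neg [IsProbabilityMeasure P] (hγ : ∀ k, 0 < γ k)
    (hX : ∀ k, HasLaw (fun ω => ‖u k ω‖ ^ 2 * ‖v k ω‖ ^ 2) (gammaProduct NR NT) P)
    (hI : iIndepFun (fun k ω => ‖u k ω‖ ^ 2 * ‖v k ω‖ ^ 2) P) (s : ℂ) :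
    ∫ x : ℝ, (x : ℂ) ^ (-s) ∂P.map (XIR γ u v) =
      ∏ k, ∫ x : ℝ, (1 + (γ k / NT : ℝ) * x : ℂ) ^ (-s) ∂gammaProduct NR NT := by
  rw [integral_map (aemeasurable_XIR hX) (Measurable.aestronglyMeasurable (by fun_prop))]
  have h1 : ∀ ω, (XIR γ u v ω : ℂ) ^ (-s) =
      ∏ k, (1 + (γ k / NT : ℝ) * (‖u k ω‖ ^ 2 * ‖v k ω‖ ^ 2 : ℝ) : ℂ) ^ (-s) := fun ω => by
    rw [XIR, Complex.ofReal_prod_cpow _ fun k => zero_le_one.trans (one_le_factor hγ k ω)]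
    push_cast
    rfl
  simp_rw [h1]
  rw [hI.integral_fun_prod_comp (f := fun k (x : ℝ) => (1 + (γ k / NT : ℝ) * (x : ℂ)) ^ (-s))
    (fun k => (hX k).aemeasurable) fun k => Measurable.aestronglyMeasurable (by fun_prop)]
  refine Finset.prod_congr rfl fun k _ => ?_
  exact (hX k).integral_comp (f := fun x : ℝ => (1 + (γ k / NT : ℝ) * (x : ℂ)) ^ (-s))
    (Measurable.aestronglyMeasurable (by fun_prop))

theorem nullSingletonClass_map_XIR [IsProbabilityMeasure P] (hK : 1 ≤ K) (hNT : 1 ≤ NT) (hNR : 1 ≤ NR) (hγ : ∀ k, 0 < γ k)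
    (hX : ∀ k, HasLaw (fun ω => ‖u k ω‖ ^ 2 * ‖v k ω‖ ^ 2) (gammaProduct NR NT) P)
    (hI : iIndepFun (fun k ω => ‖u k ω‖ ^ 2 * ‖v k ω‖ ^ 2) P) :
    NullSingletonClass (P.map (XIR γ u v)) := by
  have hNT0 : (0 : ℝ) < NT := by exact_mod_cast hNT
  let Y : Fin K → Ω → ℝ := fun k ω => 1 + γ k / NT * (‖u k ω‖ ^ 2 * ‖v k ω‖ ^ 2)
  have hY : ∀ k, AEMeasurable (Y k) P := fun k => ((hX k).aemeasurable.const_mul _).const_add _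
  have hYI : iIndepFun Y P :=
    hI.comp (γ := fun _ => ℝ) (fun k x => 1 + γ k / NT * x) fun k => by fun_prop
  -- One atomless factor is enough, and `1 ≤ K` provides it.
  let k₀ : Fin K := ⟨0, hK⟩
  have hind := (hYI.indepFun_finsetProd_of_notMem₀ hY (Finset.notMem_erase k₀ Finset.univ)).symm
  have e : XIR γ u v = fun ω => Y k₀ ω * (∏ k ∈ Finset.univ.erase k₀, Y k) ω := by
    ext ω
    rw [Finset.prod_apply, Finset.mul_prod_erase _ (fun k => Y k ω) (Finset.mem_univ _)]
    rfl
  rw [e]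
  refine nullSingletonClass_map_mul (hY k₀) (Finset.aemeasurable_prod _ fun k _ => hY k) hind ?_ ?_
  · refine nullSingletonClass_map_one_add_mul (hX k₀).aemeasurable ?_ (div_pos (hγ k₀) hNT0).ne'
    rw [(hX k₀).map_eq]
    exact nullSingletonClass_gammaProduct hNT hNR
  · refine Filter.Eventually.of_forall fun ω => ?_
    rw [Finset.prod_apply]
    exact Finset.prod_ne_zero_iff.2 fun k _ => (zero_lt_one.trans_le (one_le_factor hγ k ω)).ne'

theorem irIntegrand_eq [IsProbabilityMeasure P] (hNT : 1 ≤ NT) (hNR : 1 ≤ NR) (hγ : ∀ k, 0 < γ k)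
    (hX : ∀ k, HasLaw (fun ω => ‖u k ω‖ ^ 2 * ‖v k ω‖ ^ 2) (gammaProduct NR NT) P)
    (hI : iIndepFun (fun k ω => ‖u k ω‖ ^ 2 * ‖v k ω‖ ^ 2) P) (x : ℝ) {s : ℂ} (hs : 0 < s.re) :
    irIntegrand NT NR γ x s =
      (x : ℂ) ^ s / s * ∫ r : ℝ, (r : ℂ) ^ (-s) ∂P.map (XIR γ u v) := by
  have hNT0 : (0 : ℝ) < NT := by exact_mod_cast hNT
  rw [irIntegrand, integral_XIR_cpow_neg hγ hX hI]
  congr 1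
  refine Finset.prod_congr rfl fun k _ => ?_
  have h := meijerG_eq hs hNT hNR (div_pos (hγ k) hNT0)
  rw [inv_div] at h
  rw [h]
  exact mul_div_cancel_left₀ _ (mul_ne_zero
    (mul_ne_zero (Gamma_natCast_ne_zero hNT) (Gamma_natCast_ne_zero hNR))
    (Complex.Gamma_ne_zero_of_re_pos hs))

theorem verticalIntegrable_moments [IsProbabilityMeasure P] (hK : 1 ≤ K) (hNT : 1 ≤ NT) (hNR : 1 ≤ NR)
    (hγ : ∀ k, 0 < γ k)
    (hX : ∀ k, HasLaw (fun ω => ‖u k ω‖ ^ 2 * ‖v k ω‖ ^ 2) (gammaProduct NR NT) P)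
    (hI : iIndepFun (fun k ω => ‖u k ω‖ ^ 2 * ‖v k ω‖ ^ 2) P) {σ : ℝ} (hσ : 0 < σ) :
    Complex.VerticalIntegrable
      (fun s => (∫ r : ℝ, (r : ℂ) ^ (-s) ∂P.map (XIR γ u v)) / s) σ := by
  have hNT0 : (0 : ℝ) < NT := by exact_mod_cast hNT
  have := isProbabilityMeasure_gammaProduct hNR hNT
  have := Measure.isProbabilityMeasure_map (aemeasurable_XIR (γ := γ) hX)
  -- Decay is taken from this single factor; dividing by `s` raises the exponent from `1/2` to
  -- `3/2`, which is integrable.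
  let k₀ : Fin K := ⟨0, hK⟩
  obtain ⟨C, hC⟩ := exists_norm_integral_one_add_mul_cpow_neg_le hNR hNT (div_pos (hγ k₀) hNT0)
  refine ((integrable_rpow_neg_norm_line hσ (r := 3 / 2) (by norm_num)).const_mul C).mono' ?_
    (Filter.Eventually.of_forall fun y => ?_)
  · refine AEStronglyMeasurable.div₀ ?_ (Measurable.aestronglyMeasurable (by fun_prop))
    have hm : Measurable fun p : ℝ × ℝ => (p.2 : ℂ) ^ (-(σ + p.1 * Complex.I)) := by fun_prop
    exact (hm.stronglyMeasurable.integral_prod_right' (ν := P.map (XIR γ u v))).aestronglyMeasurable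
  set s : ℂ := σ + y * Complex.I with hs
  have hre : 0 < s.re := by simpa [hs] using hσ
  have hs0 : 0 < ‖s‖ := norm_pos_iff.2 fun h => by simp [h] at hre
  have hle : ∀ k, ‖∫ x : ℝ, (1 + (γ k / NT : ℝ) * x : ℂ) ^ (-s) ∂gammaProduct NR NT‖ ≤ 1 := by
    intro k
    have h := norm_integral_le_of_norm_le_const (μ := gammaProduct NR NT) (C := 1)
      (f := fun x : ℝ => (1 + (γ k / NT : ℝ) * x : ℂ) ^ (-s)) (by
        filter_upwards [ae_pos_gammaProduct hNR hNT] with x hx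
        exact norm_one_add_mul_cpow_neg_le_one (div_pos (hγ k) hNT0) hx.le hre)
    simpa only [probReal_univ, mul_one] using h
  dsimp only
  rw [integral_XIR_cpow_neg hγ hX hI, norm_div, norm_prod, div_le_iff₀ hs0,
    ← Finset.mul_prod_erase _ _ (Finset.mem_univ k₀)]
  calc _ ≤ ‖∫ x : ℝ, (1 + (γ k₀ / NT : ℝ) * x : ℂ) ^ (-s) ∂gammaProduct NR NT‖ * 1 :=
        mul_le_mul_of_nonneg_left (Finset.prod_le_one (fun _ _ => norm_nonneg _) fun k _ => hle k)
          (norm_nonneg _)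
    _ ≤ C * ‖s‖ ^ (-(1 / 2) : ℝ) := by rw [mul_one]; exact hC s hre
    _ = C * ‖s‖ ^ (-(3 / 2) : ℝ) * ‖s‖ := by
      rw [mul_assoc, ← Real.rpow_add_one hs0.ne']
      norm_num

theorem outageIR_eq_cdf [IsProbabilityMeasure P] (hγ : ∀ k, 0 < γ k)
    (hm : AEMeasurable (XIR γ u v) P) (h0 : NullSingletonClass (P.map (XIR γ u v))) (R : ℝ) :
    outageIR P γ u v R = cdf (P.map (XIR γ u v)) ((2 : ℝ) ^ R) := by
  have := Measure.isProbabilityMeasure_map hm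
  have hset : {ω | ∑ k, mutualInfo (γ k) (channel (u k ω) (v k ω)) < R} =
      XIR γ u v ⁻¹' Set.Iio ((2 : ℝ) ^ R) := by
    ext ω
    simp only [mutualInfo_channel, Set.mem_ofPred_eq, Set.mem_preimage, Set.mem_Iio]
    rw [← Real.logb_prod _ _ fun k _ => (zero_lt_one.trans_le (one_le_factor hγ k ω)).ne']
    exact Real.logb_lt_iff_lt_rpow one_lt_two (zero_lt_one.trans_le (one_le_XIR hγ ω))
  -- The outage event is strict and the cdf is not; they agree because the law has no atoms.
  rw [outageIR, hset, cdf_eq_real, measureReal_congr Iio_ae_eq_Iic.symm,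
    map_measureReal_apply_of_aemeasurable hm measurableSet_Iio]

end Model

end KeyholeHARQ

/-! ### The main theorem -/

theorem theorem4 {Ω : Type*} [MeasurableSpace Ω] (P : Measure Ω) [IsProbabilityMeasure P]
    (K NT NR : ℕ) (hK : 1 ≤ K) (hNT : 1 ≤ NT) (hNR : 1 ≤ NR)
    (γ : Fin K → ℝ) (hγ : ∀ k, 0 < γ k)
    (u : Fin K → Ω → EuclideanSpace ℂ (Fin NR)) (v : Fin K → Ω → EuclideanSpace ℂ (Fin NT))
    (hu : ∀ k, HasLaw (u k) (KeyholeHARQ.complexGaussianVector NR) P)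
    (hv : ∀ k, HasLaw (v k) (KeyholeHARQ.complexGaussianVector NT) P)
    (huv : ∀ k, IndepFun (u k) (v k) P)
    (hH : iIndepFun (m := fun _ => (MeasurableSpace.pi : MeasurableSpace (Fin NR → Fin NT → ℂ)))
      (fun k ω => KeyholeHARQ.channel (u k ω) (v k ω)) P) :
    (∀ k, ∀ s : ℂ, 0 < s.re →
      KeyholeHARQ.MeijerGWellDefined 3 1 ![1] ![s, (NT : ℂ), (NR : ℂ)] ((NT / γ k : ℝ) : ℂ)) ∧
    ∀ c : ℝ, c < 0 →
      (∀ x : ℝ, 0 < x →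
        Complex.VerticalIntegrable (KeyholeHARQ.irIntegrand NT NR γ x) (-c) ∧
        (cdf (P.map (KeyholeHARQ.XIR γ u v)) x : ℂ) =
          KeyholeHARQ.lineIntegral (-c) (KeyholeHARQ.irIntegrand NT NR γ x)) ∧
      (∀ R : ℝ,
        (KeyholeHARQ.outageIR P γ u v R : ℂ) =
          KeyholeHARQ.lineIntegral (-c) (KeyholeHARQ.irIntegrand NT NR γ ((2 : ℝ) ^ R))) := by
  have hNT0 : (0 : ℝ) < NT := by exact_mod_cast hNT
  have hX := fun k => KeyholeHARQ.hasLaw_gain hNT hNR (hu k) (hv k) (huv k)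
  have hI := KeyholeHARQ.iIndepFun_gain hH
  have hm := KeyholeHARQ.aemeasurable_XIR (γ := γ) hX
  have h0 := KeyholeHARQ.nullSingletonClass_map_XIR hK hNT hNR hγ hX hI
  have := Measure.isProbabilityMeasure_map hm
  have h1 : ∀ᵐ y ∂P.map (KeyholeHARQ.XIR γ u v), 1 ≤ y :=
    (ae_map_iff hm measurableSet_Ici).2
      (Filter.Eventually.of_forall fun ω => KeyholeHARQ.one_le_XIR hγ ω)
  refine ⟨fun k s hs => ?_, fun c hc => ?_⟩
  · have h := KeyholeHARQ.meijerGWellDefined hs hNT hNR (div_pos (hγ k) hNT0)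
    rwa [inv_div] at h
  have hσ : 0 < -c := neg_pos.2 hc
  have hv' := KeyholeHARQ.verticalIntegrable_moments hK hNT hNR hγ hX hI hσ
  have hline : ∀ (x y : ℝ), KeyholeHARQ.irIntegrand NT NR γ x ((-c : ℝ) + y * Complex.I) = _ :=
    fun x y => KeyholeHARQ.irIntegrand_eq hNT hNR hγ hX hI x
      (s := (-c : ℝ) + y * Complex.I) (by simpa using hc)
  have hcdf : ∀ x : ℝ, 0 < x → (cdf (P.map (KeyholeHARQ.XIR γ u v)) x : ℂ) =
      KeyholeHARQ.lineIntegral (-c) (KeyholeHARQ.irIntegrand NT NR γ x) := fun x hx => by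
    rw [cdf_eq_integral_moments h1 hσ hv' hx, KeyholeHARQ.lineIntegral_eq]
    simp_rw [hline]
  refine ⟨fun x hx => ⟨?_, hcdf x hx⟩, fun R => ?_⟩
  · have hxc : Continuous fun y : ℝ => (x : ℂ) ^ ((-c : ℝ) + y * Complex.I) :=
      Continuous.const_cpow (by fun_prop) (Or.inl (by exact_mod_cast hx.ne'))
    -- On the line `|x^s| = x^(-c)` is constant, so integrability is inherited from the moments
    -- divided by `s`.
    refine (hv'.bdd_mul (c := x ^ (-c)) hxc.aestronglyMeasurable
      (Filter.Eventually.of_forall fun y => ?_)).congr (Filter.Eventually.of_forall fun y => ?_)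
    · rw [Complex.norm_cpow_eq_rpow_re_of_pos hx]
      simp
    · simp only [hline]
      ring
  · rw [KeyholeHARQ.outageIR_eq_cdf hγ hm h0, hcdf _ (by positivity)]
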